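/- Let $p:\mathbb R^2\to\mathbb T^2=\mathbb R^2/\mathbb Z^2$ be the projection and let $E^1,E^2\subset\mathbb R^2$ be two different lines through $0$ with irrational slopes. A *quasi-Markov partition* (qMp) for $E^1,E^2$ is a finite family of nondegenerate parallelograms $\Pi_1,\dots,\Pi_k\subset\mathbb R^2$ with sides parallel to $E^1$ and $E^2$ such that $p$ is injective on each $\operatorname{int}\Pi_i$, the sets $P_i^\circ=p(\operatorname{int}\Pi_i)$ are pairwise disjoint, and $\mathbb T^2\setminus\bigcup_iP_i^\circ$ is a finite union of arcs, each being the projection of a segment parallel to $E^1$ or to $E^2$; we write $P_i=p(\Pi_i)$. A *T-configuration* for $E^1,E^2$ consists of a choice $\{E,E'\}=\{E^1,E^2\}$ of the roles of the two lines, a point $P=p(Q)\in\mathbb T^2$, one of the two rays $L=\{z(t):t\ge0\}$ of the line $E'+Q$ starting at $z(0)=Q$ ($t$ being proportional to the distance from $Q$), and an arc $I$ which is the projection of a segment of $E+Q$ containing $Q$ in its interior, such that for some $0<t_A<t_B$ the points $A=p(z(t_A))$ and $B=p(z(t_B))$ are the two endpoints of $I$, and $p(z(t))\notin I$ for $0<t<t_B$,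 $t\ne t_A$. (1) For every T-configuration there is a first parameter $t_C>t_B$ with $p(z(t_C))\in I$; the point $C=p(z(t_C))$ is not an endpoint of $I$; and the arcs $I$ and $PC=\{p(z(t)):0\le t\le t_C\}$ divide the torus into two parallelograms: there is a two-element qMp $\{\Pi_1,\Pi_2\}$ for $E^1,E^2$ such that $\mathbb T^2\setminus(I\cup PC)=P_1^\circ\sqcup P_2^\circ$. (2) Conversely, for every two-element qMp $\{\Pi_1,\Pi_2\}$ for $E^1,E^2$ there is a T-configuration for which $\mathbb T^2\setminus(I\cup PC)=P_1^\circ\sqcup P_2^\circ$. (3) Let $A\in GL(2,\mathbb Z)$ be hyperbolic, i.e. with eigenvalues $|\mu|<1<|\lambda|$, let $E^s,E^u$ be the corresponding eigenlines, and let $\widehat A$ be the induced automorphism of $\mathbb T^2$. Take a T-configuration for the lines $E^s,E^u$ (in either order of roles) such that $\widehat A(P)=P$ and such that the eigenvalue of $A$ on the line $E'$ containing the direction of the leg $L$ is positive. Then $t_C$ and the partition into two parallelograms exist as in (1), and any such partition is a *pre-Markov partition* for $\widehat A$: it is a qMp for $E^s,E^u$, each contracting side (projection of a side of $\Pi_i$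 parallel to $E^s$) of any $\widehat A(P_i)$ lies on a contracting side of some $P_j$, and each expanding side (parallel to $E^u$) of any $P_i$ lies on an expanding side of some $\widehat A(P_j)$. -/

import Mathlib

open Set

/-- The plane `ℝ²`. -/
abbrev Plane : Type := Fin 2 → ℝ

/-- The torus `𝕋² = (ℝ/ℤ)²`. -/
abbrev Torus : Type := UnitAddTorus (Fin 2)

/-- The standard projection `p : ℝ² → 𝕋²`. -/
def torusProj (x : Plane) : Torus := fun i => (x i : UnitAddCircle)

theorem torusProj_eq_iff (x y : Plane) :
    torusProj x = torusProj y ↔ ∃ n : Fin 2 → ℤ, ∀ i, y i = x i + n i := by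
  have key : ∀ a b : ℝ, ((a : UnitAddCircle) = (b : UnitAddCircle)) ↔ ∃ n : ℤ, b = a + n := by
    intro a b
    rw [eq_comm, ← sub_eq_zero, ← AddCircle.coe_sub, AddCircle.coe_eq_zero_iff]
    constructor
    · rintro ⟨n, hn⟩
      refine ⟨n, ?_⟩
      simp only [zsmul_eq_mul, mul_one] at hn
      linarith
    · rintro ⟨n, hn⟩
      refine ⟨n, ?_⟩
      simp only [zsmul_eq_mul, mul_one]
      linarith
  unfold torusProj
  rw [funext_iff]
  simp only [key]
  exact Classical.skolem

/-- The line in the direction `v` has an irrational angular coefficient. -/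
def IrrationalSlope (v : Plane) : Prop := v 0 ≠ 0 ∧ Irrational (v 1 / v 0)

/-- Two different directions `E⁰ = ℝ e₀`, `E¹ = ℝ e₁` in the plane, both with irrational angular
coefficients. -/
structure IsIrrationalPair (e : Fin 2 → Plane) : Prop where
  linearIndependent : LinearIndependent ℝ e
  irrational : ∀ j, IrrationalSlope (e j)

/-- The projection to the torus of the segment `{q + s v : a ≤ s ≤ b}`: an arc of the leaf through
`p q` of the linear foliation in the direction `v`. -/
def torusArc (v q : Plane) (a b : ℝ) : Set Torus :=
  (fun s : ℝ => torusProj (q + s • v)) '' Icc a b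

/-- A (nondegenerate) arc lying on a leaf of one of the two linear foliations. -/
def IsLeafArc (e : Fin 2 → Plane) (S : Set Torus) : Prop :=
  ∃ (j : Fin 2) (q : Plane) (a : ℝ), 0 < a ∧ S = torusArc (e j) q 0 a

/-- A nondegenerate parallelogram
`Π = {corner + s₀ e₀ + s₁ e₁ : 0 ≤ s₀ ≤ len 0, 0 ≤ s₁ ≤ len 1}` in the plane, with sides parallel to
`e₀` and `e₁`. -/
structure Parallelogram (e : Fin 2 → Plane) where
  corner : Plane
  len : Fin 2 → ℝ
  len_pos : ∀ j, 0 < len j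

namespace Parallelogram

variable {e : Fin 2 → Plane}

/-- The point of the plane with coordinates `s` relative to the corner and the sides of `Π`. -/
def point (Q : Parallelogram e) (s : Fin 2 → ℝ) : Plane := Q.corner + ∑ j, s j • e j

/-- The interior of `Π` in the plane. -/
def inner (Q : Parallelogram e) : Set Plane := Q.point '' {s | ∀ j, s j ∈ Ioo 0 (Q.len j)}

/-- The image `P° = p (int Π)` in the torus. -/
def torusInner (Q : Parallelogram e) : Set Torus := torusProj '' Q.inner

/-- `S` is the projection to the torus of one of the two sides of `Π` parallel to `e j`. -/
def IsSide (Q : Parallelogram e) (j : Fin 2) (S : Set Torus) : Prop :=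
  ∃ c : ℝ, (c = 0 ∨ c = Q.len (1 - j)) ∧
    S = torusArc (e j) (Q.corner + c • e (1 - j)) 0 (Q.len j)

end Parallelogram

/-- A quasi-Markov partition for the directions `e₀`, `e₁`: a finite system of parallelograms with
sides in these directions such that `p` is injective on the interior of each of them, the images
`P_i°` of the interiors are pairwise disjoint, and the complement of their union is a finite union
of arcs lying on leaves of the two foliations. Each element `P_i` is given through a planar
parallelogram `Π_i` that projects onto it. -/
structure IsQuasiMarkovPartition {ι : Type} [Finite ι] (e : Fin 2 → Plane)
    (R : ι → Parallelogram e) : Prop where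
  injOn : ∀ i, InjOn torusProj (R i).inner
  disjoint : ∀ i j, i ≠ j → Disjoint (R i).torusInner (R j).torusInner
  complement : ∃ F : Set (Set Torus), F.Finite ∧ (∀ S ∈ F, IsLeafArc e S) ∧
    (⋃ i, (R i).torusInner)ᶜ = ⋃₀ F

/-- A T-configuration for the directions `e₀`, `e₁`. -/
structure TConfiguration (e : Fin 2 → Plane) where
  /-- A lift `Q` of the initial point `P = p Q`. -/
  base : Plane
  /-- The direction of the crossbar `I` is `e bar`; the leg `L` has the other one, `e (1 - bar)`. -/
  bar : Fin 2
  /-- Which of the two rays starting at `Q` is `L`. -/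
  sign : ℝ
  sign_eq : sign = 1 ∨ sign = -1
  /-- The crossbar `I` is the projection of `{Q + s e_bar : lo ≤ s ≤ hi}`. -/
  lo : ℝ
  hi : ℝ
  lo_neg : lo < 0
  hi_pos : 0 < hi
  /-- The parameters on `L` of the endpoints `A`, `B` of `I`. -/
  tA : ℝ
  tB : ℝ
  tA_pos : 0 < tA
  tA_lt_tB : tA < tB
  /-- `A = p (z tA)` and `B = p (z tB)` are the two endpoints of `I`, in either order. -/
  endpoints :
    (torusProj (base + (sign * tA) • e (1 - bar)) = torusProj (base + lo • e bar) ∧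
      torusProj (base + (sign * tB) • e (1 - bar)) = torusProj (base + hi • e bar)) ∨
    (torusProj (base + (sign * tA) • e (1 - bar)) = torusProj (base + hi • e bar) ∧
      torusProj (base + (sign * tB) • e (1 - bar)) = torusProj (base + lo • e bar))
  /-- `p (z t)` is not on `I` for `0 < t < tB`, `t ≠ tA`. -/
  avoids : ∀ t, 0 < t → t < tB → t ≠ tA →
    torusProj (base + (sign * t) • e (1 - bar)) ∉ torusArc (e bar) base lo hi

namespace TConfiguration

variable {e : Fin 2 → Plane}

/-- The initial point `P`. -/
def initialPoint (T : TConfiguration e) : Torus := torusProj T.base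

/-- The point `p (z t)` of the projected leg `p L`. -/
def legPoint (T : TConfiguration e) (t : ℝ) : Torus :=
  torusProj (T.base + (T.sign * t) • e (1 - T.bar))

/-- The arc `I`. -/
def crossbar (T : TConfiguration e) : Set Torus := torusArc (e T.bar) T.base T.lo T.hi

/-- The arc `I` without its endpoints. -/
def crossbarInterior (T : TConfiguration e) : Set Torus :=
  (fun s : ℝ => torusProj (T.base + s • e T.bar)) '' Ioo T.lo T.hi

/-- `c` is the parameter of the point `C`, the next after `B` intersection of `p L` with `I`. -/
def IsNextHit (T : TConfiguration e) (c : ℝ) : Prop :=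
  T.tB < c ∧ T.legPoint c ∈ T.crossbar ∧ ∀ t, T.tB < t → t < c → T.legPoint t ∉ T.crossbar

/-- For `c` the parameter of `C`: the arc `PC` of the projected leg. -/
def legArc (T : TConfiguration e) (c : ℝ) : Set Torus := T.legPoint '' Icc 0 c

/-- The arcs `I` and `PC` cut the torus into the parallelograms `R 0`, `R 1`: these form a
quasi-Markov partition and the complement of `I ∪ PC` is the (disjoint) union of their
interiors. -/
structure CutsInto (T : TConfiguration e) (c : ℝ) (R : Fin 2 → Parallelogram e) : Prop where
  quasiMarkov : IsQuasiMarkovPartition e R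
  compl_eq : (T.crossbar ∪ T.legArc c)ᶜ = ⋃ i, (R i).torusInner

end TConfiguration

/-- The toric automorphism `Â` induced by `A ∈ GL(2, ℤ)`. -/
def toralAut (A : GL (Fin 2) ℤ) (x : Torus) : Torus :=
  fun i => ∑ j, (A : Matrix (Fin 2) (Fin 2) ℤ) i j • x j

/-- The real matrix of `A ∈ GL(2, ℤ)`. -/
def realMatrix (A : GL (Fin 2) ℤ) : Matrix (Fin 2) (Fin 2) ℝ :=
  (A : Matrix (Fin 2) (Fin 2) ℤ).map (fun n : ℤ => (n : ℝ))

theorem toralAut_torusProj (A : GL (Fin 2) ℤ) (x : Plane) :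
    toralAut A (torusProj x) = torusProj ((realMatrix A).mulVec x) := by
  funext i
  simp only [toralAut, torusProj, realMatrix, Matrix.mulVec, dotProduct, Fin.sum_univ_two,
    Matrix.map_apply, AddCircle.coe_add, ← zsmul_eq_mul, AddCircle.coe_zsmul]

/-- `A` is hyperbolic with stable eigenvalue `ev 0` and unstable eigenvalue `ev 1`, and the
eigendirections `E^s`, `E^u` are spanned by `e 0`, `e 1`. -/
structure IsHyperbolicFrame (A : GL (Fin 2) ℤ) (e : Fin 2 → Plane) (ev : Fin 2 → ℝ) : Prop where
  stable_lt : |ev 0| < 1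
  unstable_gt : 1 < |ev 1|
  ne_zero : ∀ j, e j ≠ 0
  eigen : ∀ j, (realMatrix A).mulVec (e j) = ev j • e j

/-- A pre-Markov partition for the hyperbolic automorphism `Â`: a partition into parallelograms
with sides parallel to `E^s = ℝ e₀` and `E^u = ℝ e₁` such that each contracting side of any `Â P_i`
lies on a contracting side of some `P_j`, and each expanding side of any `P_i` lies on an expanding
side of some `Â P_j`. -/
structure IsPreMarkovPartition {ι : Type} [Finite ι] (A : GL (Fin 2) ℤ) (e : Fin 2 → Plane)
    (R : ι → Parallelogram e) : Prop where
  hyperbolic : ∃ ev, IsHyperbolicFrame A e ev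
  quasiMarkov : IsQuasiMarkovPartition e R
  stable : ∀ i S, (R i).IsSide 0 S → ∃ j S', (R j).IsSide 0 S' ∧ toralAut A '' S ⊆ S'
  unstable : ∀ i S, (R i).IsSide 1 S → ∃ j S', (R j).IsSide 1 S' ∧ S ⊆ toralAut A '' S'

/-! Take `Q` as the origin and the directions of the crossbar and of the leg as axes. The integer
lattice becomes a group `Λ`, and irrationality of the slopes says that `Λ` has no nonzero point on
either axis. The crossbar is `[-a, b] × {0}`, and the leg at parameter `y` meets the crossbar at
parameter `x` exactly when `(-x, y) ∈ Λ`. So the two endpoint hits are lattice vectors `(a, s)` and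
`(-b, t)`, where `s`, `t` are `tA`, `tB` in some order.

For (1), translates by these two vectors of the L-shaped region `[0, b) × [0, s) ∪ [-a, 0) × [0, t)`
cover the plane (`stairCovered`). Since the leg avoids the crossbar before `B` except at `A`, the
two vectors generate `Λ` (`IsStairBasis.of_avoids`). The L-shape is then a fundamental domain whose
two boxes are the required parallelograms, and the next hit `C` is the sum `(a - b, s + t)` of the
generators.

For (2), a two-element partition lifts to a tiling of the plane by translates of two boxes. Matching
corners of adjacent boxes, with axis-freeness forbidding a box to be adjacent to itself along a full
side, puts the two boxes side by side on a common base line and makes their dimensions a stair basis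
(`IsBoxTiling.exists_stair`, `IsBoxTiling.isStairBasis`).

For (3), the automorphism is a diagonal scaling of the axes that preserves `Λ`. It, or its inverse,
contracts the crossbar by `κ` and expands the leg by `μ > 1`. Because all hits up to height `s + t`
are known, the contracted crossbar lies in one of the two parts of `I` cut off by `C`
(`scale_crossbar`), and the leg `PC` shrunk by `μ` lies in `PB` (`add_le_mul_max`). These target
arcs lie on sides of the parallelograms. The partition cut out by the arcs is unique up to integer
translations (`exists_corner_eq_and_len_eq`), so the conclusion holds for every such partition. -/

/-! ### Stair bases: L-shaped fundamental domains of a planar lattice. -/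

/-- A subgroup of `ℝ × ℝ` without nonzero elements on the coordinate axes. -/
structure IsAxisFree (Λ : AddSubgroup (ℝ × ℝ)) : Prop where
  fst : ∀ x : ℝ, (x, (0 : ℝ)) ∈ Λ → x = 0
  snd : ∀ y : ℝ, ((0 : ℝ), y) ∈ Λ → y = 0

/-- The vectors `(a, s)`, `(-b, t)`, with `a, b, s, t > 0`, generate the subgroup `Λ`. -/
structure IsStairBasis (Λ : AddSubgroup (ℝ × ℝ)) (a b s t : ℝ) : Prop where
  a_pos : 0 < a
  b_pos : 0 < b
  s_pos : 0 < s
  t_pos : 0 < t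
  right_mem : (a, s) ∈ Λ
  left_mem : (-b, t) ∈ Λ
  span : ∀ z ∈ Λ, ∃ m n : ℤ, z = (m * a - n * b, m * s + n * t)

/-- A nonzero coefficient moves a point by at least one full generator. Splitting both coefficients
in this way reduces questions about lattice points near the boxes to linear inequalities. -/
theorem int_mul_trichotomy (m : ℤ) {a s : ℝ} (ha : 0 < a) (hs : 0 < s) :
    ((m : ℝ) * a ≤ -a ∧ (m : ℝ) * s ≤ -s) ∨ m = 0 ∨ (a ≤ m * a ∧ s ≤ m * s) := by
  rcases lt_trichotomy m 0 with h | h | h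
  · left
    have h' : (m : ℝ) ≤ -1 := by exact_mod_cast (by omega : m ≤ -1)
    constructor <;> nlinarith
  · exact Or.inr (Or.inl h)
  · right; right
    have h' : (1 : ℝ) ≤ m := by exact_mod_cast (by omega : 1 ≤ m)
    constructor <;> nlinarith

theorem stair_mem {Λ : AddSubgroup (ℝ × ℝ)} {a b s t : ℝ} (hu : (a, s) ∈ Λ) (hw : (-b, t) ∈ Λ)
    (m n : ℤ) : ((m : ℝ) * a - n * b, (m : ℝ) * s + n * t) ∈ Λ := by
  have := Λ.add_mem (Λ.zsmul_mem hu m) (Λ.zsmul_mem hw n)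
  convert this using 1
  ext <;> simp [sub_eq_add_neg]

/-- Up to a translation in the group generated by `(a, s)` and `(-b, t)`, the point `(x, y)` is in
the union of `[0, b) × [0, s)` and `[-a, 0) × [0, t)`. -/
def StairCovered (a b s t x y : ℝ) : Prop :=
  ∃ m n : ℤ,
    (x + (m * a - n * b) ∈ Ico 0 b ∧ y + (m * s + n * t) ∈ Ico 0 s) ∨
    (x + (m * a - n * b) ∈ Ico (-a) 0 ∧ y + (m * s + n * t) ∈ Ico 0 t)

theorem StairCovered.of_translate {a b s t x y : ℝ} (m n : ℤ)
    (h : StairCovered a b s t (x + (m * a - n * b)) (y + (m * s + n * t))) :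
    StairCovered a b s t x y := by
  obtain ⟨m', n', h⟩ := h
  refine ⟨m + m', n + n', ?_⟩
  have h1 : x + (m * a - n * b) + (m' * a - n' * b)
      = x + (((m + m' : ℤ) : ℝ) * a - ((n + n' : ℤ) : ℝ) * b) := by push_cast; ring
  have h2 : y + (m * s + n * t) + (m' * s + n' * t)
      = y + (((m + m' : ℤ) : ℝ) * s + ((n + n' : ℤ) : ℝ) * t) := by push_cast; ring
  rwa [h1, h2] at h

/-- Descend from a point above the L-shape: over `[0, b)` subtract `(a, s)`, over `[-a, 0)` subtract
`(-b, t)`. Each move stays in the strip `[-a, b)` and lowers the height by at least `d`, without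
passing below `0`. -/
theorem stairCovered_of_nonneg {a b s t d : ℝ} (ha : 0 < a) (hb : 0 < b) (hds : d ≤ s) (hdt : d ≤ t) (N : ℕ) :
    ∀ x y : ℝ, x ∈ Ico (-a) b → 0 ≤ y → y < N * d → StairCovered a b s t x y := by
  induction N with
  | zero => intro x y _ h0 h1; simp at h1; linarith
  | succ N ih =>
    intro x y hx h0 h1
    push_cast at h1
    rcases le_or_gt 0 x with h | h
    · rcases lt_or_ge y s with hy | hy
      · exact ⟨0, 0, Or.inl ⟨by simpa using ⟨h, hx.2⟩, by simpa using ⟨h0, hy⟩⟩⟩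
      · apply StairCovered.of_translate (-1) 0
        apply ih
        · have := hx.2
          constructor <;> push_cast <;> linarith
        · push_cast; linarith
        · push_cast; linarith
    · rcases lt_or_ge y t with hy | hy
      · exact ⟨0, 0, Or.inr ⟨by simpa using ⟨hx.1, h⟩, by simpa using ⟨h0, hy⟩⟩⟩
      · apply StairCovered.of_translate 0 (-1)
        have := hx.1
        apply ih
        · constructor <;> push_cast <;> linarith
        · push_cast; linarith
        · push_cast; linarith

/-- Every point is first moved into the strip `[-a, b)`, then raised to nonnegative height by
generators that keep it in the strip, then lowered into the L-shape. -/
theorem stairCovered {a b s t : ℝ} (ha : 0 < a) (hb : 0 < b) (hs : 0 < s) (ht : 0 < t)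
    (x y : ℝ) : StairCovered a b s t x y := by
  have hd : 0 < min s t := lt_min hs ht
  have hds := min_le_left s t
  have hdt := min_le_right s t
  have up : ∀ N : ℕ, ∀ x y : ℝ, x ∈ Ico (-a) b → -(N * min s t) ≤ y →
      StairCovered a b s t x y := by
    intro N
    induction N with
    | zero =>
      intro x y hx h0
      obtain ⟨M, hM⟩ := exists_nat_gt (y / min s t)
      exact stairCovered_of_nonneg ha hb hds hdt M x y hx (by simpa using h0)
        ((div_lt_iff₀ hd).1 hM)
    | succ N ih =>
      intro x y hx h0
      push_cast at h0
      have h1 := hx.1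
      have h2 := hx.2
      rcases lt_or_ge x (b - a) with h | h
      · apply StairCovered.of_translate 1 0
        apply ih
        · constructor <;> push_cast <;> linarith
        · push_cast; linarith
      · apply StairCovered.of_translate 0 1
        apply ih
        · constructor <;> push_cast <;> linarith
        · push_cast; linarith
  have hab : 0 < a + b := by linarith
  set k : ℤ := ⌊(x + a) / (a + b)⌋
  have hk1 : (k : ℝ) * (a + b) ≤ x + a := (le_div_iff₀ hab).1 (Int.floor_le _)
  have hk2 : x + a < (k + 1) * (a + b) := (div_lt_iff₀ hab).1 (Int.lt_floor_add_one _)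
  -- The difference of the two generators has horizontal component `±(a + b)`, the width of the
  -- strip.
  apply StairCovered.of_translate (-k) k
  obtain ⟨N, hN⟩ := exists_nat_gt (-(y + (((-k : ℤ) : ℝ) * s + k * t)) / min s t)
  rw [div_lt_iff₀ hd] at hN
  apply up N
  · constructor <;> push_cast <;> linarith
  · linarith

/-- If no nonzero element of `Λ` with the second coordinate in `(0, max s t)`, except for the given
ones, has its first coordinate in `[-b, a]`, then `(a, s)` and `(-b, t)` generate `Λ`. -/
theorem IsStairBasis.of_avoids {Λ : AddSubgroup (ℝ × ℝ)} (hΛ : IsAxisFree Λ) {a b s t : ℝ}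
    (ha : 0 < a) (hb : 0 < b) (hs : 0 < s) (ht : 0 < t) (hu : (a, s) ∈ Λ) (hw : (-b, t) ∈ Λ)
    (avoids : ∀ x y : ℝ, 0 < y → y < max s t → y ≠ s → y ≠ t → x ∈ Icc (-b) a → (x, y) ∉ Λ) :
    IsStairBasis Λ a b s t := by
  refine ⟨ha, hb, hs, ht, hu, hw, ?_⟩
  have key : ∀ x y : ℝ, 0 < y → y ≤ max s t → x ∈ Icc (-b) a → (x, y) ∈ Λ →
      (x, y) = (a, s) ∨ (x, y) = (-b, t) := by
    intro x y hy0 hy1 hx hmem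
    by_cases hys : y = s
    · left
      have := hΛ.fst (x - a) (by simpa [hys] using Λ.sub_mem hmem hu)
      rw [hys, sub_eq_zero.1 this]
    by_cases hyt : y = t
    · right
      have := hΛ.fst (x + b) (by simpa [hyt] using Λ.sub_mem hmem hw)
      rw [hyt, eq_neg_of_add_eq_zero_left this]
    refine absurd hmem (avoids x y hy0 (lt_of_le_of_ne hy1 fun h => ?_) hys hyt hx)
    rcases max_choice s t with h' | h' <;> rw [h'] at h <;> contradiction
  rintro ⟨x, y⟩ hz
  -- Covering `-z` rather than `z` places `z` minus a combination in the reflected L-shape. Adding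
  -- one generator then gives a lattice point with positive height at most `max s t` and abscissa in
  -- `[-b, a]`, where only the generators themselves are allowed.
  obtain ⟨m, n, h⟩ := stairCovered ha hb hs ht (-x) (-y)
  have hmem := Λ.sub_mem hz (stair_mem hu hw m n)
  simp only [Prod.mk_sub_mk] at hmem
  rcases h with ⟨h1, h2⟩ | ⟨h1, h2⟩
  · have h3 := Λ.add_mem hu hmem
    simp only [Prod.mk_add_mk] at h3
    rcases key _ _ (by linarith [h2.2]) (by linarith [h2.1, le_max_left s t])
      ⟨by linarith [h1.2], by linarith [h1.1]⟩ h3 with h | h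
    · refine ⟨m, n, ?_⟩
      simp only [Prod.mk.injEq] at h ⊢
      constructor <;> linarith [h.1, h.2]
    · refine ⟨m - 1, n + 1, ?_⟩
      simp only [Prod.mk.injEq] at h ⊢
      push_cast
      constructor <;> linarith [h.1, h.2]
  · have h3 := Λ.add_mem hw hmem
    simp only [Prod.mk_add_mk] at h3
    rcases key _ _ (by linarith [h2.2]) (by linarith [h2.1, le_max_right s t])
      ⟨by linarith [h1.2], by linarith [h1.1]⟩ h3 with h | h
    · refine ⟨m + 1, n - 1, ?_⟩
      simp only [Prod.mk.injEq] at h ⊢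
      push_cast
      constructor <;> linarith [h.1, h.2]
    · refine ⟨m, n, ?_⟩
      simp only [Prod.mk.injEq] at h ⊢
      constructor <;> linarith [h.1, h.2]

/-- If no nonzero element of `Λ` is in `[0, b) × [0, s)` or `[-a, 0) × [0, t)`, then `(a, s)` and
`(-b, t)` generate `Λ`. -/
theorem IsStairBasis.of_no_return {Λ : AddSubgroup (ℝ × ℝ)} {a b s t : ℝ}
    (ha : 0 < a) (hb : 0 < b) (hs : 0 < s) (ht : 0 < t) (hu : (a, s) ∈ Λ) (hw : (-b, t) ∈ Λ)
    (h : ∀ x y : ℝ, (x, y) ∈ Λ →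
      (x ∈ Ico 0 b ∧ y ∈ Ico 0 s) ∨ (x ∈ Ico (-a) 0 ∧ y ∈ Ico 0 t) → x = 0 ∧ y = 0) :
    IsStairBasis Λ a b s t := by
  refine ⟨ha, hb, hs, ht, hu, hw, ?_⟩
  rintro ⟨x, y⟩ hz
  obtain ⟨m, n, hmn⟩ := stairCovered ha hb hs ht x y
  obtain ⟨h1, h2⟩ := h _ _ (by simpa using Λ.add_mem hz (stair_mem hu hw m n)) hmn
  refine ⟨-m, -n, ?_⟩
  simp only [Prod.mk.injEq]
  push_cast
  constructor <;> linarith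

namespace IsStairBasis

variable {Λ : AddSubgroup (ℝ × ℝ)} {a b s t : ℝ}

/-- The two open boxes of a stair basis. -/
def boxes (a b s t : ℝ) : Set (ℝ × ℝ) := Ioo 0 b ×ˢ Ioo 0 s ∪ Ioo (-a) 0 ×ˢ Ioo 0 t

/-- A vertical segment of length `s + t` from the crossbar meets the crossbar `[-a, b] × {0}` modulo
`Λ` only at the heights `0`, `s`, `t`, `s + t`. -/
theorem height_of_mem (h : IsStairBasis Λ a b s t) {x y : ℝ} (hmem : (x, y) ∈ Λ)
    (hx : x ∈ Icc (-b) a) (hy0 : 0 ≤ y) (hy1 : y ≤ s + t) :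
    (x, y) = (0, 0) ∨ (x, y) = (a, s) ∨ (x, y) = (-b, t) ∨ (x, y) = (a - b, s + t) := by
  obtain ⟨m, n, he⟩ := h.span _ hmem
  have ha := h.a_pos
  have hb := h.b_pos
  have hs := h.s_pos
  have ht := h.t_pos
  simp only [Prod.mk.injEq] at he
  obtain ⟨rfl, rfl⟩ := he
  obtain ⟨hx0, hx1⟩ := hx
  -- Coefficients of opposite signs push the abscissa out of `[-b, a]`; if neither is positive and
  -- not both vanish, the height is negative. What remains is bounded by the width when one
  -- coefficient is zero and by the height when both are positive.
  have key : (m = 0 ∧ n = 0) ∨ (m = 1 ∧ n = 0) ∨ (m = 0 ∧ n = 1) ∨ (m = 1 ∧ n = 1) := by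
    have e1 : m ≤ 1 → m = 1 ∨ m ≤ 0 := fun h => by omega
    rcases int_mul_trichotomy m ha hs with h1 | rfl | h1 <;>
      rcases int_mul_trichotomy n hb ht with h2 | rfl | h2
    · exfalso; linarith
    · exfalso; simp at *; linarith
    · exfalso; linarith
    · exfalso; simp at *; linarith
    · simp
    · simp at *
      have : (n : ℝ) ≤ 1 := by nlinarith
      have h3 : n ≤ 1 := by exact_mod_cast this
      have h4 : (0 : ℝ) < n := by nlinarith
      have h5 : 0 < n := by exact_mod_cast h4
      omega
    · exfalso; linarith
    · simp at *
      have : (m : ℝ) ≤ 1 := by nlinarith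
      have h3 : m ≤ 1 := by exact_mod_cast this
      have h4 : (0 : ℝ) < m := by nlinarith
      have h5 : 0 < m := by exact_mod_cast h4
      omega
    · have h3 : (m : ℝ) ≤ 1 := by nlinarith
      have h4 : (n : ℝ) ≤ 1 := by nlinarith
      have h5 : (0 : ℝ) < m := by nlinarith
      have h6 : (0 : ℝ) < n := by nlinarith
      norm_cast at h3 h4 h5 h6
      omega
  rcases key with ⟨rfl, rfl⟩ | ⟨rfl, rfl⟩ | ⟨rfl, rfl⟩ | ⟨rfl, rfl⟩ <;> simp

/-- Two points of the open boxes that are congruent modulo `Λ` are equal. -/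
theorem eq_of_mem_boxes (h : IsStairBasis Λ a b s t) {z z' : ℝ × ℝ} (hz : z ∈ boxes a b s t)
    (hz' : z' ∈ boxes a b s t) (hmem : z' - z ∈ Λ) : z = z' := by
  obtain ⟨m, n, he⟩ := h.span _ hmem
  have ha := h.a_pos
  have hb := h.b_pos
  have hs := h.s_pos
  have ht := h.t_pos
  obtain ⟨x, y⟩ := z
  obtain ⟨x', y'⟩ := z'
  simp only [Prod.mk_sub_mk, Prod.mk.injEq] at he
  obtain ⟨h1, h2⟩ := he
  have key : m = 0 ∧ n = 0 := by
    simp only [boxes, mem_union, mem_prod, mem_Ioo] at hz hz'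
    rcases int_mul_trichotomy m ha hs with h3 | rfl | h3 <;>
      rcases int_mul_trichotomy n hb ht with h4 | rfl | h4 <;>
      first
      | exact ⟨rfl, rfl⟩
      | (exfalso
         try simp only [Int.cast_zero, zero_mul] at h1 h2
         rcases hz with ⟨⟨_, _⟩, _, _⟩ | ⟨⟨_, _⟩, _, _⟩ <;>
         rcases hz' with ⟨⟨_, _⟩, _, _⟩ | ⟨⟨_, _⟩, _, _⟩ <;> linarith)
  obtain ⟨rfl, rfl⟩ := key
  simp only [Int.cast_zero, zero_mul, sub_zero, add_zero] at h1 h2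
  ext <;> simp <;> linarith

/-- The crossbar `[-a, b] × {0}` does not meet the open boxes modulo `Λ`. -/
theorem crossbar_disjoint (h : IsStairBasis Λ a b s t) {z : ℝ × ℝ} (hz : z ∈ boxes a b s t) {x : ℝ}
    (hx : x ∈ Icc (-a) b) : (x, 0) - z ∉ Λ := by
  intro hmem
  obtain ⟨m, n, he⟩ := h.span _ hmem
  have ha := h.a_pos
  have hb := h.b_pos
  have hs := h.s_pos
  have ht := h.t_pos
  obtain ⟨x', y'⟩ := z
  obtain ⟨hx0, hx1⟩ := hx
  simp only [Prod.mk_sub_mk, Prod.mk.injEq] at he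
  obtain ⟨h1, h2⟩ := he
  simp only [boxes, mem_union, mem_prod, mem_Ioo] at hz
  rcases int_mul_trichotomy m ha hs with h3 | rfl | h3 <;>
    rcases int_mul_trichotomy n hb ht with h4 | rfl | h4 <;>
    (try simp only [Int.cast_zero, zero_mul] at h1 h2) <;>
    rcases hz with ⟨⟨_, _⟩, _, _⟩ | ⟨⟨_, _⟩, _, _⟩ <;> linarith

/-- The leg `{0} × [0, s + t]` does not meet the open boxes modulo `Λ`. -/
theorem leg_disjoint (h : IsStairBasis Λ a b s t) {z : ℝ × ℝ} (hz : z ∈ boxes a b s t) {y : ℝ}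
    (hy : y ∈ Icc 0 (s + t)) : (0, y) - z ∉ Λ := by
  intro hmem
  obtain ⟨m, n, he⟩ := h.span _ hmem
  have ha := h.a_pos
  have hb := h.b_pos
  have hs := h.s_pos
  have ht := h.t_pos
  obtain ⟨x', y'⟩ := z
  obtain ⟨hx0, hx1⟩ := hy
  simp only [Prod.mk_sub_mk, Prod.mk.injEq] at he
  obtain ⟨h1, h2⟩ := he
  simp only [boxes, mem_union, mem_prod, mem_Ioo] at hz
  rcases int_mul_trichotomy m ha hs with h3 | rfl | h3 <;>
    rcases int_mul_trichotomy n hb ht with h4 | rfl | h4 <;>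
    (try simp only [Int.cast_zero, zero_mul] at h1 h2) <;>
    rcases hz with ⟨⟨_, _⟩, _, _⟩ | ⟨⟨_, _⟩, _, _⟩ <;> linarith

/-- Modulo `Λ`, every point is on the crossbar, on the leg, or in one of the open boxes. -/
theorem crossbar_or_leg_or_boxes (h : IsStairBasis Λ a b s t) (z : ℝ × ℝ) :
    (∃ x ∈ Icc (-a) b, (x, 0) - z ∈ Λ) ∨ (∃ y ∈ Icc 0 (s + t), (0, y) - z ∈ Λ) ∨
      ∃ z' ∈ boxes a b s t, z' - z ∈ Λ := by
  have ha := h.a_pos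
  have hb := h.b_pos
  have hs := h.s_pos
  have ht := h.t_pos
  obtain ⟨x, y⟩ := z
  obtain ⟨m, n, hmn⟩ := stairCovered ha hb hs ht x y
  have hmem := stair_mem h.right_mem h.left_mem m n
  have hmem' : (x + (m * a - n * b), y + (m * s + n * t)) - (x, y) ∈ Λ := by
    simpa using hmem
  rcases eq_or_ne (y + (m * s + n * t)) 0 with h0 | h0
  · left
    refine ⟨x + (m * a - n * b), ?_, by rwa [h0] at hmem'⟩
    rcases hmn with ⟨⟨_, _⟩, _, _⟩ | ⟨⟨_, _⟩, _, _⟩ <;> constructor <;> linarith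
  rcases eq_or_ne (x + (m * a - n * b)) 0 with h1 | h1
  · right; left
    refine ⟨y + (m * s + n * t), ?_, by rwa [h1] at hmem'⟩
    rcases hmn with ⟨⟨_, _⟩, _, _⟩ | ⟨⟨_, _⟩, _, _⟩ <;> constructor <;> linarith
  rcases hmn with ⟨h2, h3⟩ | ⟨h2, h3⟩
  · right; right
    exact ⟨_, Or.inl ⟨⟨lt_of_le_of_ne h2.1 h1.symm, h2.2⟩, lt_of_le_of_ne h3.1 h0.symm, h3.2⟩,
      hmem'⟩
  -- The left edge of the L-shape is glued by `(a, s)` to the part of the leg above height `s`.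
  rcases eq_or_ne (x + (m * a - n * b)) (-a) with h4 | h4
  · right; left
    refine ⟨y + (m * s + n * t) + s, ⟨by linarith [h3.1], by linarith [h3.2]⟩, ?_⟩
    have := Λ.add_mem h.right_mem hmem'
    rw [h4] at this
    convert this using 1
    ext <;> simp <;> ring
  · right; right
    exact ⟨_, Or.inr ⟨⟨lt_of_le_of_ne h2.1 h4.symm, h2.2⟩, lt_of_le_of_ne h3.1 h0.symm, h3.2⟩,
      hmem'⟩

end IsStairBasis

/-! ### Frame coordinates on the plane and the torus. -/

/-- The point with coordinates `z` in the frame with origin `q` and axes `f`, `g`. -/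
def framePoint (q f g : Plane) (z : ℝ × ℝ) : Plane := q + z.1 • f + z.2 • g

/-- The projection to the torus in the coordinates of the frame `q`, `f`, `g`. -/
def frameProj (q f g : Plane) (z : ℝ × ℝ) : Torus := torusProj (framePoint q f g z)

/-- The integer lattice in the coordinates of the frame `f`, `g`. -/
def frameLattice (f g : Plane) : AddSubgroup (ℝ × ℝ) where
  carrier := {z | ∃ n : Fin 2 → ℤ, ∀ i, z.1 * f i + z.2 * g i = n i}
  zero_mem' := ⟨0, by simp⟩
  add_mem' := by
    rintro z z' ⟨n, hn⟩ ⟨n', hn'⟩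
    refine ⟨n + n', fun i => ?_⟩
    simp only [Prod.fst_add, Prod.snd_add, Pi.add_apply, Int.cast_add, ← hn i, ← hn' i]
    ring
  neg_mem' := by
    rintro z ⟨n, hn⟩
    refine ⟨-n, fun i => ?_⟩
    simp only [Prod.fst_neg, Prod.snd_neg, Pi.neg_apply, Int.cast_neg, ← hn i]
    ring

theorem mem_frameLattice {f g : Plane} {z : ℝ × ℝ} :
    z ∈ frameLattice f g ↔ ∃ n : Fin 2 → ℤ, ∀ i, z.1 * f i + z.2 * g i = n i := Iff.rfl

theorem frameProj_eq_iff {q f g : Plane} {z z' : ℝ × ℝ} :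
    frameProj q f g z = frameProj q f g z' ↔ z' - z ∈ frameLattice f g := by
  rw [frameProj, frameProj, torusProj_eq_iff, mem_frameLattice]
  refine exists_congr fun n => forall_congr' fun i => ?_
  simp only [framePoint, Pi.add_apply, Pi.smul_apply, smul_eq_mul, Prod.fst_sub, Prod.snd_sub]
  constructor <;> intro h <;> linarith

theorem torusProj_surjective : Function.Surjective torusProj := by
  intro x
  choose y hy using fun i => QuotientAddGroup.mk_surjective (x i)
  exact ⟨y, funext hy⟩

theorem framePoint_surjective {f g : Plane} (h : LinearIndependent ℝ ![f, g]) (q : Plane) :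
    Function.Surjective (framePoint q f g) := by
  intro x
  have hspan := h.span_eq_top_of_card_eq_finrank' (by simp)
  have hx : x - q ∈ Submodule.span ℝ (range ![f, g]) := hspan ▸ Submodule.mem_top
  simp only [Matrix.range_cons, Matrix.range_empty, union_empty, singleton_union] at hx
  obtain ⟨u, v, huv⟩ := Submodule.mem_span_pair.1 hx
  exact ⟨(u, v), by rw [framePoint, add_assoc, huv]; abel⟩

theorem framePoint_injective {f g : Plane} (h : LinearIndependent ℝ ![f, g]) (q : Plane) :
    Function.Injective (framePoint q f g) := by
  intro z z' hz
  have h0 : (z.1 - z'.1) • f + (z.2 - z'.2) • g = 0 := by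
    have : framePoint q f g z - framePoint q f g z' = 0 := by rw [hz, sub_self]
    rw [← this, framePoint, framePoint]
    module
  obtain ⟨h1, h2⟩ := LinearIndependent.pair_iff.1 h _ _ h0
  exact Prod.ext (sub_eq_zero.1 h1) (sub_eq_zero.1 h2)

theorem frameProj_surjective {f g : Plane} (h : LinearIndependent ℝ ![f, g]) (q : Plane) :
    Function.Surjective (frameProj q f g) :=
  torusProj_surjective.comp (framePoint_surjective h q)

theorem IrrationalSlope.smul {v : Plane} (h : IrrationalSlope v) {c : ℝ} (hc : c ≠ 0) :
    IrrationalSlope (c • v) := by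
  refine ⟨mul_ne_zero hc h.1, ?_⟩
  simpa only [Pi.smul_apply, smul_eq_mul, mul_div_mul_left _ _ hc] using h.2

theorem IrrationalSlope.eq_zero {v : Plane} (h : IrrationalSlope v) {x : ℝ} {n : Fin 2 → ℤ}
    (hn : ∀ i, x * v i = n i) : x = 0 := by
  by_contra hx
  refine h.2 ⟨(n 1 : ℚ) / n 0, ?_⟩
  push_cast
  rw [← hn 1, ← hn 0, mul_div_mul_left _ _ hx]

theorem isAxisFree_frameLattice {f g : Plane} (hf : IrrationalSlope f) (hg : IrrationalSlope g) :
    IsAxisFree (frameLattice f g) := by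
  constructor
  · rintro x ⟨n, hn⟩
    exact hf.eq_zero (n := n) fun i => by simpa using hn i
  · rintro x ⟨n, hn⟩
    exact hg.eq_zero (n := n) fun i => by simpa using hn i

theorem one_sub_ne (j : Fin 2) : 1 - j ≠ j := by fin_cases j <;> decide

theorem one_sub_one_sub (j : Fin 2) : 1 - (1 - j) = j := by fin_cases j <;> decide

theorem eq_or_eq_one_sub (i j : Fin 2) : i = j ∨ i = 1 - j := by
  fin_cases i <;> fin_cases j <;> decide

theorem sum_eq_add_one_sub {M : Type*} [AddCommMonoid M] (j : Fin 2) (F : Fin 2 → M) :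
    ∑ i, F i = F j + F (1 - j) := by
  fin_cases j
  · simp
  · simp [add_comm]

theorem forall_iff_and_one_sub (j : Fin 2) (p : Fin 2 → Prop) :
    (∀ i, p i) ↔ p j ∧ p (1 - j) :=
  ⟨fun h => ⟨h _, h _⟩, fun h i => by
    rcases eq_or_eq_one_sub i j with rfl | rfl
    exacts [h.1, h.2]⟩

namespace IsIrrationalPair

variable {e : Fin 2 → Plane} {σ : ℝ}

theorem linearIndependent_frame (he : IsIrrationalPair e) (j : Fin 2) (hσ : σ ≠ 0) :
    LinearIndependent ℝ ![e j, σ • e (1 - j)] := by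
  have h := he.linearIndependent
  rw [LinearIndependent.pair_iff]
  intro x y hxy
  rw [Fintype.linearIndependent_iff] at h
  have h2 := h (fun i => if i = j then x else y * σ) (by
    rw [sum_eq_add_one_sub j]
    simpa [one_sub_ne, mul_smul] using hxy)
  have hj := h2 j
  have hj' := h2 (1 - j)
  simp only [if_true, one_sub_ne, if_false, mul_eq_zero, hσ, or_false] at hj hj'
  exact ⟨hj, hj'⟩

theorem isAxisFree (he : IsIrrationalPair e) (j : Fin 2) (hσ : σ ≠ 0) :
    IsAxisFree (frameLattice (e j) (σ • e (1 - j))) :=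
  isAxisFree_frameLattice (he.irrational j) ((he.irrational (1 - j)).smul hσ)

end IsIrrationalPair

theorem frameProj_image_horizontal (q f g : Plane) (x₀ x₁ y : ℝ) :
    frameProj q f g '' (Icc x₀ x₁ ×ˢ {y}) = torusArc f (framePoint q f g (x₀, y)) 0 (x₁ - x₀) := by
  ext p
  simp only [torusArc, mem_image, mem_prod, mem_singleton_iff, mem_Icc, Prod.exists]
  constructor
  · rintro ⟨x, _, ⟨h, rfl⟩, rfl⟩
    refine ⟨x - x₀, ⟨by linarith, by linarith⟩, congrArg torusProj ?_⟩
    simp only [framePoint]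
    module
  · rintro ⟨s, h, rfl⟩
    refine ⟨x₀ + s, y, ⟨⟨by linarith, by linarith⟩, rfl⟩, congrArg torusProj ?_⟩
    simp only [framePoint]
    module

/-- A `torusArc` with parameters from `0` to a positive length runs in the direction `+v` whatever
`σ` is. For `σ = -1` its initial point is therefore the end with parameter `y₁`, and the `min`
selects the correct end in both cases. -/
theorem frameProj_image_vertical (q f v : Plane) {σ : ℝ} (hσ : σ = 1 ∨ σ = -1) (x : ℝ) {y₀ y₁ : ℝ}
    (hy : y₀ ≤ y₁) :
    frameProj q f (σ • v) '' ({x} ×ˢ Icc y₀ y₁) =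
      torusArc v (q + x • f + min (σ * y₀) (σ * y₁) • v) 0 (y₁ - y₀) := by
  ext p
  simp only [torusArc, mem_image, mem_prod, mem_singleton_iff, mem_Icc, Prod.exists]
  rcases hσ with rfl | rfl
  · rw [min_eq_left (by linarith)]
    constructor
    · rintro ⟨_, y, ⟨rfl, h⟩, rfl⟩
      refine ⟨y - y₀, ⟨by linarith, by linarith⟩, congrArg torusProj ?_⟩
      simp only [framePoint]
      module
    · rintro ⟨s, h, rfl⟩
      refine ⟨x, y₀ + s, ⟨rfl, by linarith, by linarith⟩, congrArg torusProj ?_⟩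
      simp only [framePoint]
      module
  · rw [min_eq_right (by linarith)]
    constructor
    · rintro ⟨_, y, ⟨rfl, h⟩, rfl⟩
      refine ⟨y₁ - y, ⟨by linarith, by linarith⟩, congrArg torusProj ?_⟩
      simp only [framePoint]
      module
    · rintro ⟨s, h, rfl⟩
      refine ⟨x, y₁ - s, ⟨rfl, by linarith, by linarith⟩, congrArg torusProj ?_⟩
      simp only [framePoint]
      module

theorem isLeafArc_horizontal (e : Fin 2 → Plane) (j : Fin 2) (q g : Plane) {x₀ x₁ : ℝ}
    (hx : x₀ < x₁) (y : ℝ) : IsLeafArc e (frameProj q (e j) g '' (Icc x₀ x₁ ×ˢ {y})) :=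
  ⟨j, _, _, sub_pos.2 hx, frameProj_image_horizontal q (e j) g x₀ x₁ y⟩

theorem isLeafArc_vertical (e : Fin 2 → Plane) (j : Fin 2) (q f : Plane) {σ : ℝ}
    (hσ : σ = 1 ∨ σ = -1) (x : ℝ) {y₀ y₁ : ℝ} (hy : y₀ < y₁) :
    IsLeafArc e (frameProj q f (σ • e j) '' ({x} ×ˢ Icc y₀ y₁)) :=
  ⟨j, _, _, sub_pos.2 hy, frameProj_image_vertical q f (e j) hσ x hy.le⟩

/-! ### Coordinate boxes as parallelograms, and their sides. -/

/-- The box `[x₀, x₁] × [y₀, y₁]` in the frame `q`, `e j`, `σ • e (1 - j)` (with `σ = ±1`), as a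
parallelogram. -/
def boxParallelogram (e : Fin 2 → Plane) (q : Plane) (j : Fin 2) (σ : ℝ) {x₀ x₁ y₀ y₁ : ℝ}
    (hx : x₀ < x₁) (hy : y₀ < y₁) : Parallelogram e where
  corner := q + x₀ • e j + min (σ * y₀) (σ * y₁) • e (1 - j)
  len i := if i = j then x₁ - x₀ else y₁ - y₀
  len_pos i := by split_ifs <;> linarith

section Box

variable {e : Fin 2 → Plane} {q : Plane} {j : Fin 2} {σ : ℝ} {x₀ x₁ y₀ y₁ : ℝ}
  (hx : x₀ < x₁) (hy : y₀ < y₁)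

theorem boxParallelogram_inner (hσ : σ = 1 ∨ σ = -1) :
    (boxParallelogram e q j σ hx hy).inner =
      framePoint q (e j) (σ • e (1 - j)) '' (Ioo x₀ x₁ ×ˢ Ioo y₀ y₁) := by
  ext p
  simp only [Parallelogram.inner, Parallelogram.point, boxParallelogram, mem_image, mem_ofPred_eq,
    forall_iff_and_one_sub j, sum_eq_add_one_sub j, if_true, one_sub_ne, if_false, mem_prod,
    mem_Ioo, Prod.exists]
  rcases hσ with rfl | rfl
  · rw [min_eq_left (by linarith)]
    constructor
    · rintro ⟨s, h, rfl⟩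
      refine ⟨x₀ + s j, y₀ + s (1 - j), ⟨⟨?_, ?_⟩, ?_, ?_⟩, ?_⟩ <;> try linarith [h.1.1, h.2.1]
      simp only [framePoint]
      module
    · rintro ⟨x, y, h, rfl⟩
      refine ⟨fun i => if i = j then x - x₀ else y - y₀, ?_⟩
      simp only [if_true, one_sub_ne, if_false]
      refine ⟨⟨⟨?_, ?_⟩, ?_, ?_⟩, ?_⟩ <;> try linarith
      simp only [framePoint]
      module
  · rw [min_eq_right (by linarith)]
    constructor
    · rintro ⟨s, h, rfl⟩
      refine ⟨x₀ + s j, y₁ - s (1 - j), ⟨⟨?_, ?_⟩, ?_, ?_⟩, ?_⟩ <;> try linarith [h.1.1, h.2.1]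
      simp only [framePoint]
      module
    · rintro ⟨x, y, h, rfl⟩
      refine ⟨fun i => if i = j then x - x₀ else y₁ - y, ?_⟩
      simp only [if_true, one_sub_ne, if_false]
      refine ⟨⟨⟨?_, ?_⟩, ?_, ?_⟩, ?_⟩ <;> try linarith
      simp only [framePoint]
      module

theorem boxParallelogram_torusInner (hσ : σ = 1 ∨ σ = -1) :
    (boxParallelogram e q j σ hx hy).torusInner =
      frameProj q (e j) (σ • e (1 - j)) '' (Ioo x₀ x₁ ×ˢ Ioo y₀ y₁) := by
  rw [Parallelogram.torusInner, boxParallelogram_inner hx hy hσ, image_image]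
  rfl

theorem boxParallelogram_isSide_bar (hσ : σ = 1 ∨ σ = -1) (S : Set Torus) :
    (boxParallelogram e q j σ hx hy).IsSide j S ↔ ∃ y, (y = y₀ ∨ y = y₁) ∧
      S = frameProj q (e j) (σ • e (1 - j)) '' (Icc x₀ x₁ ×ˢ {y}) := by
  simp only [Parallelogram.IsSide, boxParallelogram, if_true, one_sub_ne, if_false,
    frameProj_image_horizontal]
  rcases hσ with rfl | rfl
  · rw [min_eq_left (by linarith)]
    constructor
    · rintro ⟨c, hc, rfl⟩
      refine ⟨y₀ + c, by rcases hc with rfl | rfl <;> simp, congrArg (torusArc _ · _ _) ?_⟩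
      simp only [framePoint]
      module
    · rintro ⟨y, hc, rfl⟩
      refine ⟨y - y₀, by rcases hc with rfl | rfl <;> simp, congrArg (torusArc _ · _ _) ?_⟩
      simp only [framePoint]
      module
  · rw [min_eq_right (by linarith)]
    constructor
    · rintro ⟨c, hc, rfl⟩
      refine ⟨y₁ - c, by rcases hc with rfl | rfl <;> simp, congrArg (torusArc _ · _ _) ?_⟩
      simp only [framePoint]
      module
    · rintro ⟨y, hc, rfl⟩
      refine ⟨y₁ - y, by rcases hc with rfl | rfl <;> simp, congrArg (torusArc _ · _ _) ?_⟩
      simp only [framePoint]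
      module

theorem boxParallelogram_isSide_leg (hσ : σ = 1 ∨ σ = -1) (S : Set Torus) :
    (boxParallelogram e q j σ hx hy).IsSide (1 - j) S ↔ ∃ x, (x = x₀ ∨ x = x₁) ∧
      S = frameProj q (e j) (σ • e (1 - j)) '' ({x} ×ˢ Icc y₀ y₁) := by
  simp only [Parallelogram.IsSide, boxParallelogram, if_true, one_sub_ne, if_false,
    one_sub_one_sub, frameProj_image_vertical _ _ _ hσ _ hy.le]
  constructor
  · rintro ⟨c, hc, rfl⟩
    refine ⟨x₀ + c, by rcases hc with rfl | rfl <;> simp, congrArg (torusArc _ · _ _) ?_⟩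
    module
  · rintro ⟨x, hc, rfl⟩
    refine ⟨x - x₀, by rcases hc with rfl | rfl <;> simp, congrArg (torusArc _ · _ _) ?_⟩
    module

end Box

/-! ### The quasi-Markov partition of a stair basis. -/

/-- The two parallelograms of a stair basis, in the frame `q`, `e j`, `σ • e (1 - j)`. -/
def stairParallelogram (e : Fin 2 → Plane) (q : Plane) (j : Fin 2) (σ : ℝ)
    {Λ : AddSubgroup (ℝ × ℝ)} {a b s t : ℝ} (h : IsStairBasis Λ a b s t) :
    Fin 2 → Parallelogram e :=
  ![boxParallelogram e q j σ h.b_pos h.s_pos,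
    boxParallelogram e q j σ (neg_lt_zero.2 h.a_pos) h.t_pos]

section Stair

open IsStairBasis

theorem frameProj_compl_crossbar_union_leg {f g : Plane} (hfg : LinearIndependent ℝ ![f, g])
    (q : Plane) {a b s t : ℝ} (h : IsStairBasis (frameLattice f g) a b s t) :
    (frameProj q f g '' (Icc (-a) b ×ˢ {0}) ∪ frameProj q f g '' ({0} ×ˢ Icc 0 (s + t)))ᶜ =
      frameProj q f g '' boxes a b s t := by
  ext p
  obtain ⟨z, rfl⟩ := frameProj_surjective hfg q p
  simp only [mem_compl_iff, mem_union, not_or]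
  constructor
  · rintro ⟨h1, h2⟩
    rcases h.crossbar_or_leg_or_boxes z with ⟨x, hx, hm⟩ | ⟨y, hy, hm⟩ | ⟨z', hz', hm⟩
    · exact absurd ⟨(x, 0), ⟨hx, rfl⟩, (frameProj_eq_iff.2 hm).symm⟩ h1
    · exact absurd ⟨(0, y), ⟨rfl, hy⟩, (frameProj_eq_iff.2 hm).symm⟩ h2
    · exact ⟨z', hz', (frameProj_eq_iff.2 hm).symm⟩
  · rintro ⟨z', hz', he⟩
    constructor
    · rintro ⟨⟨x, y⟩, ⟨hx, hy⟩, he'⟩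
      obtain rfl : y = 0 := hy
      exact h.crossbar_disjoint hz' hx (frameProj_eq_iff.1 (he.trans he'.symm))
    · rintro ⟨⟨x, y⟩, ⟨hx, hy⟩, he'⟩
      obtain rfl : x = 0 := hx
      exact h.leg_disjoint hz' hy (frameProj_eq_iff.1 (he.trans he'.symm))

variable {e : Fin 2 → Plane} {q : Plane} {j : Fin 2} {σ : ℝ} {a b s t : ℝ}

theorem stairParallelogram_iUnion (hσ : σ = 1 ∨ σ = -1) {Λ : AddSubgroup (ℝ × ℝ)}
    (h : IsStairBasis Λ a b s t) :
    ⋃ i, (stairParallelogram e q j σ h i).torusInner =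
      frameProj q (e j) (σ • e (1 - j)) '' boxes a b s t := by
  rw [boxes, image_union]
  ext p
  simp [stairParallelogram, boxParallelogram_torusInner _ _ hσ]

theorem stairParallelogram_injOn (hσ : σ = 1 ∨ σ = -1)
    (h : IsStairBasis (frameLattice (e j) (σ • e (1 - j))) a b s t) (i : Fin 2) :
    InjOn torusProj (stairParallelogram e q j σ h i).inner := by
  have key : InjOn torusProj (framePoint q (e j) (σ • e (1 - j)) '' boxes a b s t) := by
    rintro _ ⟨z, hz, rfl⟩ _ ⟨z', hz', rfl⟩ hp
    rw [h.eq_of_mem_boxes hz hz' (frameProj_eq_iff.1 hp)]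
  refine key.mono ?_
  fin_cases i
  · simp only [stairParallelogram, Fin.zero_eta, Matrix.cons_val_zero,
      boxParallelogram_inner _ _ hσ]
    exact image_mono subset_union_left
  · simp only [stairParallelogram, Fin.mk_one, Matrix.cons_val_one, Matrix.cons_val_fin_one,
      boxParallelogram_inner _ _ hσ]
    exact image_mono subset_union_right

theorem stairParallelogram_disjoint (hσ : σ = 1 ∨ σ = -1)
    (h : IsStairBasis (frameLattice (e j) (σ • e (1 - j))) a b s t) (i i' : Fin 2) (hi : i ≠ i') :
    Disjoint (stairParallelogram e q j σ h i).torusInner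
      (stairParallelogram e q j σ h i').torusInner := by
  have key : Disjoint (stairParallelogram e q j σ h 0).torusInner
      (stairParallelogram e q j σ h 1).torusInner := by
    rw [Set.disjoint_left]
    intro p h0 h1
    simp only [stairParallelogram, Matrix.cons_val_zero, Matrix.cons_val_one,
      Matrix.cons_val_fin_one, boxParallelogram_torusInner _ _ hσ] at h0 h1
    obtain ⟨z, hz, rfl⟩ := h0
    obtain ⟨z', hz', hp⟩ := h1
    have := h.eq_of_mem_boxes (Or.inr hz') (Or.inl hz) (frameProj_eq_iff.1 hp)
    rw [this] at hz'
    exact lt_asymm hz.1.1 hz'.1.2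
  fin_cases i <;> fin_cases i'
  · exact absurd rfl hi
  · exact key
  · exact key.symm
  · exact absurd rfl hi

theorem stairParallelogram_isQuasiMarkovPartition (he : IsIrrationalPair e)
    (hσ : σ = 1 ∨ σ = -1)
    (h : IsStairBasis (frameLattice (e j) (σ • e (1 - j))) a b s t) :
    IsQuasiMarkovPartition e (stairParallelogram e q j σ h) := by
  have hσ0 : σ ≠ 0 := by rcases hσ with rfl | rfl <;> norm_num
  refine ⟨stairParallelogram_injOn hσ h, stairParallelogram_disjoint hσ h, ?_⟩
  refine ⟨{frameProj q (e j) (σ • e (1 - j)) '' (Icc (-a) b ×ˢ {0}),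
    frameProj q (e j) (σ • e (1 - j)) '' ({0} ×ˢ Icc 0 (s + t))}, by simp, ?_, ?_⟩
  · rintro S (rfl | rfl)
    · exact isLeafArc_horizontal e j q _ (by linarith [h.a_pos, h.b_pos]) 0
    · exact isLeafArc_vertical e (1 - j) q _ hσ 0 (by linarith [h.s_pos, h.t_pos])
  · rw [stairParallelogram_iUnion hσ h, sUnion_pair,
      ← frameProj_compl_crossbar_union_leg (he.linearIndependent_frame j hσ0) q h, compl_compl]

end Stair

/-! ### From a T-configuration to a stair basis. -/

namespace TConfiguration

variable {e : Fin 2 → Plane} (T : TConfiguration e)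

/-- The direction of the leg of a T-configuration, with its orientation. -/
def legDirection : Plane := T.sign • e (1 - T.bar)

/-- The integer lattice in the coordinates given by the crossbar and the leg. -/
def lattice : AddSubgroup (ℝ × ℝ) := frameLattice (e T.bar) T.legDirection

/-- The projection to the torus in the coordinates given by the crossbar and the leg. -/
def proj : ℝ × ℝ → Torus := frameProj T.base (e T.bar) T.legDirection

theorem sign_ne_zero : T.sign ≠ 0 := by
  rcases T.sign_eq with h | h <;> rw [h] <;> norm_num

variable {T}

theorem proj_eq_iff {z z' : ℝ × ℝ} : T.proj z = T.proj z' ↔ z' - z ∈ T.lattice :=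
  frameProj_eq_iff

theorem proj_fst (x : ℝ) : T.proj (x, 0) = torusProj (T.base + x • e T.bar) := by
  simp [proj, frameProj, framePoint]

theorem proj_snd (y : ℝ) : T.proj (0, y) = T.legPoint y := by
  simp [proj, frameProj, framePoint, legPoint, legDirection, smul_smul, mul_comm]

theorem mem_crossbar {p : Torus} : p ∈ T.crossbar ↔ ∃ x ∈ Icc T.lo T.hi, T.proj (x, 0) = p := by
  simp only [proj_fst]; rfl

theorem crossbar_eq : T.crossbar = T.proj '' (Icc T.lo T.hi ×ˢ {0}) := by
  ext p
  rw [mem_crossbar]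
  constructor
  · rintro ⟨x, hx, rfl⟩
    exact ⟨(x, 0), ⟨hx, rfl⟩, rfl⟩
  · rintro ⟨⟨x, y⟩, ⟨hx, hy⟩, rfl⟩
    obtain rfl : y = 0 := hy
    exact ⟨x, hx, rfl⟩

theorem legArc_eq (c : ℝ) : T.legArc c = T.proj '' ({0} ×ˢ Icc 0 c) := by
  ext p
  constructor
  · rintro ⟨y, hy, rfl⟩
    exact ⟨(0, y), ⟨rfl, hy⟩, proj_snd y⟩
  · rintro ⟨⟨x, y⟩, ⟨hx, hy⟩, rfl⟩
    obtain rfl : x = 0 := hx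
    exact ⟨y, hy, (proj_snd y).symm⟩

theorem legPoint_mem_crossbar {y : ℝ} :
    T.legPoint y ∈ T.crossbar ↔ ∃ x ∈ Icc T.lo T.hi, (-x, y) ∈ T.lattice := by
  simp only [mem_crossbar, ← proj_snd, proj_eq_iff, Prod.mk_sub_mk, zero_sub, sub_zero]

/-- The data of a T-configuration in coordinates: a stair basis of the lattice whose widths are
those of the two halves of the crossbar, and whose heights are the parameters of `A` and `B`. -/
structure IsStair (T : TConfiguration e) (s t : ℝ) : Prop where
  basis : IsStairBasis T.lattice (-T.lo) T.hi s t
  heights : (s = T.tA ∧ t = T.tB) ∨ (s = T.tB ∧ t = T.tA)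

/-- The hits at `lo` and `hi` give lattice vectors with abscissas `-lo` and `-hi`; the sign change
turns the crossbar `[lo, hi]` into the forbidden interval `[-hi, -lo]`. The two cases record which
endpoint is hit first. -/
theorem exists_isStair (he : IsIrrationalPair e) (T : TConfiguration e) :
    ∃ s t, T.IsStair s t := by
  have hΛ : IsAxisFree T.lattice := he.isAxisFree T.bar T.sign_ne_zero
  have hA := T.tA_pos
  have hAB := T.tA_lt_tB
  have avoids : ∀ x y : ℝ, 0 < y → y < T.tB → y ≠ T.tA → x ∈ Icc (-T.hi) (-T.lo) →
      (x, y) ∉ T.lattice := by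
    intro x y hy0 hy1 hy2 hx hmem
    exact T.avoids y hy0 hy1 hy2 (legPoint_mem_crossbar.2
      ⟨-x, ⟨by linarith [hx.2], by linarith [hx.1]⟩, by rwa [neg_neg]⟩)
  have aux : ∀ x y : ℝ,
      torusProj (T.base + (T.sign * y) • e (1 - T.bar)) = torusProj (T.base + x • e T.bar) →
      (-x, y) ∈ T.lattice := by
    intro x y h
    rw [← proj_fst] at h
    have h' := proj_eq_iff.1 (h.symm.trans (proj_snd y).symm)
    simpa using h'
  rcases T.endpoints with ⟨h1, h2⟩ | ⟨h1, h2⟩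
  · refine ⟨T.tA, T.tB, ?_, Or.inl ⟨rfl, rfl⟩⟩
    refine .of_avoids hΛ (neg_pos.2 T.lo_neg) T.hi_pos hA (hA.trans hAB) (aux _ _ h1) (aux _ _ h2) ?_
    intro x y h0 h1 h2 _
    rw [max_eq_right hAB.le] at h1
    exact avoids x y h0 h1 h2
  · refine ⟨T.tB, T.tA, ?_, Or.inr ⟨rfl, rfl⟩⟩
    refine .of_avoids hΛ (neg_pos.2 T.lo_neg) T.hi_pos (hA.trans hAB) hA (aux _ _ h2) (aux _ _ h1) ?_
    intro x y h0 h1 _ h2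
    rw [max_eq_left hAB.le] at h1
    exact avoids x y h0 h1 h2

namespace IsStair

variable {s t : ℝ}

theorem add_eq (h : T.IsStair s t) : s + t = T.tA + T.tB := by
  rcases h.heights with ⟨rfl, rfl⟩ | ⟨rfl, rfl⟩
  · rfl
  · exact add_comm _ _

/-- `C` corresponds to the sum of the generators, hence to the crossbar parameter `hi + lo`, which
is strictly between `lo` and `hi`. Earlier hits are excluded by `height_of_mem`. -/
theorem isNextHit (h : T.IsStair s t) : T.IsNextHit (s + t) := by
  have hA := T.tA_pos
  have hAB := T.tA_lt_tB
  have hst := h.add_eq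
  refine ⟨by linarith, ?_, ?_⟩
  · refine legPoint_mem_crossbar.2 ⟨T.hi + T.lo, ⟨by linarith [T.hi_pos], by linarith [T.lo_neg]⟩, ?_⟩
    convert T.lattice.add_mem h.basis.right_mem h.basis.left_mem using 1
    simp [add_comm]
  · intro y hy0 hy1 hmem
    obtain ⟨x, hx, hm⟩ := legPoint_mem_crossbar.1 hmem
    have := h.basis.height_of_mem hm ⟨by linarith [hx.2], by linarith [hx.1]⟩ (by linarith) hy1.le
    simp only [Prod.mk.injEq] at this
    rcases this with h1 | h1 | h1 | h1 <;> rcases h.heights with ⟨rfl, rfl⟩ | ⟨rfl, rfl⟩ <;>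
      linarith [h1.2]

theorem legPoint_mem_crossbarInterior (h : T.IsStair s t) :
    T.legPoint (s + t) ∈ T.crossbarInterior := by
  refine ⟨T.hi + T.lo, ⟨by linarith [T.hi_pos], by linarith [T.lo_neg]⟩, ?_⟩
  change torusProj _ = _
  rw [← proj_fst, ← proj_snd, proj_eq_iff]
  convert T.lattice.add_mem h.basis.right_mem h.basis.left_mem using 1
  simp [add_comm]

theorem compl_eq (he : IsIrrationalPair e) (h : T.IsStair s t) :
    (T.crossbar ∪ T.legArc (s + t))ᶜ = T.proj '' IsStairBasis.boxes (-T.lo) T.hi s t := by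
  have := frameProj_compl_crossbar_union_leg
    (he.linearIndependent_frame T.bar T.sign_ne_zero) T.base h.basis
  rw [neg_neg] at this
  rw [crossbar_eq, legArc_eq]
  exact this

theorem cutsInto (he : IsIrrationalPair e) (h : T.IsStair s t) :
    T.CutsInto (s + t) (stairParallelogram e T.base T.bar T.sign h.basis) := by
  refine ⟨stairParallelogram_isQuasiMarkovPartition he T.sign_eq h.basis, ?_⟩
  rw [h.compl_eq he, stairParallelogram_iUnion T.sign_eq h.basis]
  rfl

end IsStair

end TConfiguration

/-! ### Half-open rectangles and the matching of corners in tilings. -/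

/-- Membership in the half-open interval with endpoints `l`, `r`: closed at `l` and open at `r` if
`σ` is true, and the other way round if `σ` is false. -/
def HalfOpen (σ : Bool) (l r x : ℝ) : Prop := if σ then l ≤ x ∧ x < r else l < x ∧ x ≤ r

/-- The endpoint of the interval with endpoints `l`, `r` that the half-open interval contains. -/
def closedEnd (σ : Bool) (l r : ℝ) : ℝ := if σ then l else r

/-- The direction that points into the half-open interval from its closed end. -/
def inwardSign (σ : Bool) : ℝ := if σ then 1 else -1

theorem HalfOpen.eq_closedEnd_or {σ : Bool} {l r x : ℝ} (h : HalfOpen σ l r x) :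
    x = closedEnd σ l r ∨ HalfOpen (!σ) l r x := by
  cases σ <;> simp only [HalfOpen, closedEnd] at h ⊢ <;> simp at h ⊢
  · rcases h.2.eq_or_lt with h' | h'
    exacts [Or.inl h', Or.inr ⟨h.1.le, h'⟩]
  · rcases h.1.eq_or_lt with h' | h'
    exacts [Or.inl h'.symm, Or.inr ⟨h', h.2.le⟩]

theorem halfOpen_closedEnd {l r : ℝ} (h : l < r) (σ : Bool) : HalfOpen σ l r (closedEnd σ l r) := by
  cases σ <;> simp [HalfOpen, closedEnd, h]

theorem not_halfOpen_closedEnd (l r : ℝ) (σ : Bool) : ¬ HalfOpen (!σ) l r (closedEnd σ l r) := by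
  cases σ <;> simp [HalfOpen, closedEnd]

/-- Half-open membership means that moving slightly from `x` in the direction `inwardSign σ` leads
into the open interval. This lemma and the next one, for non-members, transfer statements between
open and half-open boxes. -/
theorem HalfOpen.eventually {σ : Bool} {l r x : ℝ} (h : HalfOpen σ l r x) :
    ∀ᶠ ε in nhdsWithin (0 : ℝ) (Ioi 0), x + inwardSign σ * ε ∈ Ioo l r := by
  cases σ <;> simp only [HalfOpen, inwardSign, if_true, Bool.false_eq_true, if_false] at h ⊢
  · filter_upwards [Ioo_mem_nhdsGT (sub_pos.2 h.1)] with ε hε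
    constructor <;> linarith [hε.1, hε.2, h.2]
  · filter_upwards [Ioo_mem_nhdsGT (sub_pos.2 h.2)] with ε hε
    constructor <;> linarith [hε.1, hε.2, h.1]

theorem eventually_notMem_of_not_halfOpen {σ : Bool} {l r x : ℝ} (h : ¬ HalfOpen σ l r x) :
    ∀ᶠ ε in nhdsWithin (0 : ℝ) (Ioi 0), x + inwardSign σ * ε ∉ Ioo l r := by
  cases σ <;> simp only [HalfOpen, inwardSign] at h ⊢ <;> simp at h ⊢
  · by_cases h1 : l < x
    · filter_upwards [Ioo_mem_nhdsGT (sub_pos.2 (h h1))] with ε hε _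
      linarith [hε.2]
    · filter_upwards [self_mem_nhdsWithin] with ε (hε : 0 < ε) h2
      linarith
  · by_cases h1 : l ≤ x
    · filter_upwards [self_mem_nhdsWithin] with ε (hε : 0 < ε) _
      linarith [h h1]
    · filter_upwards [Ioo_mem_nhdsGT (sub_pos.2 (not_le.1 h1))] with ε hε h2
      linarith [hε.2]

/-- In a family of rectangles that tiles the plane exactly, for each of the four ways of making
them half-open, each corner of a rectangle is also a corner, of an adjacent type, of a
rectangle of the family. -/
theorem exists_adjacent_corner {κ : Type*} {l r b u : κ → ℝ} (hlr : ∀ k, l k < r k)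
    (hbu : ∀ k, b k < u k)
    (h : ∀ (σ τ : Bool) (x y : ℝ),
      ∃! k, HalfOpen σ (l k) (r k) x ∧ HalfOpen τ (b k) (u k) y) (k : κ) (σ τ : Bool) :
    ∃ k', (closedEnd σ (l k) (r k) = closedEnd (!σ) (l k') (r k') ∧
        closedEnd τ (b k) (u k) = closedEnd τ (b k') (u k')) ∨
      (closedEnd σ (l k) (r k) = closedEnd σ (l k') (r k') ∧
        closedEnd τ (b k) (u k) = closedEnd (!τ) (b k') (u k')) := by
  have uniq : ∀ {σ τ : Bool} {x y : ℝ} {k k' : κ}, HalfOpen σ (l k) (r k) x →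
      HalfOpen τ (b k) (u k) y → HalfOpen σ (l k') (r k') x → HalfOpen τ (b k') (u k') y →
      k = k' := fun h1 h2 h3 h4 => (h _ _ _ _).unique ⟨h1, h2⟩ ⟨h3, h4⟩
  set x := closedEnd σ (l k) (r k) with hx
  set y := closedEnd τ (b k) (u k) with hy
  have hkx : HalfOpen σ (l k) (r k) x := halfOpen_closedEnd (hlr k) σ
  have hky : HalfOpen τ (b k) (u k) y := halfOpen_closedEnd (hbu k) τ
  -- The half-open conventions at `(x, y)` select the rectangles that occupy the quadrants there:
  -- `k` has `(σ, τ)`, `k₂` its horizontal neighbour and `k₃` its vertical neighbour. Each neighbour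
  -- must stop at the common line, or it would overlap `k`.
  obtain ⟨k₂, ⟨h2x, h2y⟩, -⟩ := h (!σ) τ x y
  obtain ⟨k₃, ⟨h3x, h3y⟩, -⟩ := h σ (!τ) x y
  have e2 : x = closedEnd (!σ) (l k₂) (r k₂) := by
    refine h2x.eq_closedEnd_or.resolve_right fun h' => ?_
    rw [Bool.not_not] at h'
    rw [← uniq hkx hky h' h2y] at h2x
    exact not_halfOpen_closedEnd _ _ _ h2x
  have e3 : y = closedEnd (!τ) (b k₃) (u k₃) := by
    refine h3y.eq_closedEnd_or.resolve_right fun h' => ?_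
    rw [Bool.not_not] at h'
    rw [← uniq hkx hky h3x h'] at h3y
    exact not_halfOpen_closedEnd _ _ _ h3y
  -- If neither neighbour has a corner at `(x, y)`, both extend into the opposite quadrant and so
  -- coincide. But `k₂` stops at the vertical line through the corner, while `k₃` extends across it.
  rcases h2y.eq_closedEnd_or with h4 | h4
  · exact ⟨k₂, Or.inl ⟨e2, h4⟩⟩
  rcases h3x.eq_closedEnd_or with h5 | h5
  · exact ⟨k₃, Or.inr ⟨h5, e3⟩⟩
  exfalso
  rw [← uniq h2x h4 h5 h3y] at h3x
  have := not_halfOpen_closedEnd (l k₂) (r k₂) (!σ)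
  rw [Bool.not_not, ← e2] at this
  exact this h3x

theorem closedEnd_add (σ : Bool) (l r c : ℝ) :
    closedEnd σ (l + c) (r + c) = closedEnd σ l r + c := by
  cases σ <;> rfl

/-- The four corners of the box `[x, x + w] × [y, y + h]`. -/
def boxCorner (x y w h : ℝ) (σ τ : Bool) : ℝ × ℝ := (closedEnd σ x (x + w), closedEnd τ y (y + h))

/-- The translates by the subgroup `Λ` of the half-open boxes `[X i, X i + w i] × [Y i, Y i + h i]`
tile the plane, for each of the four ways of making the boxes half-open. -/
def IsBoxTiling (Λ : AddSubgroup (ℝ × ℝ)) (X Y w h : Fin 2 → ℝ) : Prop :=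
  ∀ (σ τ : Bool) (x y : ℝ), ∃! k : Fin 2 × Λ,
    HalfOpen σ (X k.1 + k.2.1.1) (X k.1 + w k.1 + k.2.1.1) x ∧
    HalfOpen τ (Y k.1 + k.2.1.2) (Y k.1 + h k.1 + k.2.1.2) y

namespace IsBoxTiling

variable {Λ : AddSubgroup (ℝ × ℝ)} {X Y w h : Fin 2 → ℝ}

theorem exists_corner (H : IsBoxTiling Λ X Y w h) (hw : ∀ i, 0 < w i) (hh : ∀ i, 0 < h i)
    (i : Fin 2) (σ τ : Bool) :
    ∃ i', boxCorner (X i) (Y i) (w i) (h i) σ τ -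
        boxCorner (X i') (Y i') (w i') (h i') (!σ) τ ∈ Λ ∨
      boxCorner (X i) (Y i) (w i) (h i) σ τ -
        boxCorner (X i') (Y i') (w i') (h i') σ (!τ) ∈ Λ := by
  obtain ⟨⟨i', v⟩, h'⟩ := exists_adjacent_corner (κ := Fin 2 × Λ)
    (fun k => by linarith [hw k.1]) (fun k => by linarith [hh k.1]) H (i, 0) σ τ
  refine ⟨i', ?_⟩
  simp only [closedEnd_add, ZeroMemClass.coe_zero, Prod.fst_zero, Prod.snd_zero, add_zero] at h'
  refine h'.imp (fun h' => ?_) (fun h' => ?_) <;>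
  · convert v.2 using 1
    ext <;> simp [boxCorner, h'.1, h'.2]

/-- If the adjacent corner belonged to a translate of the same box, a side `(±w, 0)` or `(0, ±h)` of
that box would be a lattice vector on an axis. -/
theorem one_sub_corner (H : IsBoxTiling Λ X Y w h) (hΛ : IsAxisFree Λ) (hw : ∀ i, 0 < w i)
    (hh : ∀ i, 0 < h i) {i j : Fin 2} (hij : j ≠ i) (σ τ : Bool) :
    boxCorner (X i) (Y i) (w i) (h i) σ τ - boxCorner (X j) (Y j) (w j) (h j) (!σ) τ ∈ Λ ∨
      boxCorner (X i) (Y i) (w i) (h i) σ τ - boxCorner (X j) (Y j) (w j) (h j) σ (!τ) ∈ Λ := by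
  obtain ⟨i', h'⟩ := H.exists_corner hw hh i σ τ
  by_cases hi : i' = i
  · exfalso
    subst hi
    have h1 := hw i'
    have h2 := hh i'
    simp only [boxCorner, Prod.mk_sub_mk, sub_self] at h'
    rcases h' with h' | h'
    · have := hΛ.fst _ h'
      cases σ <;> simp [closedEnd] at this <;> linarith
    · have := hΛ.snd _ h'
      cases τ <;> simp [closedEnd] at this <;> linarith
  · obtain rfl : i' = j := by omega
    exact h'

theorem mem_of_mem {p q : ℝ × ℝ} (hq : q ∈ Λ) (h1 : p.1 = q.1) (h2 : p.2 = q.2) : p ∈ Λ :=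
  (Prod.ext h1 h2 : p = q) ▸ hq

/-- The hypothesis places box `j` immediately to the left of box `i` on a common base line. The
lower left corner of `j` cannot meet the lower right corner of `i`, since this would give the axis
vector `(w i + w j, 0)`; hence it meets the upper left corner of `i`. The upper right corner of `i`
then supplies the second vector. -/
theorem stair_of_adjacent (H : IsBoxTiling Λ X Y w h) (hΛ : IsAxisFree Λ) (hw : ∀ i, 0 < w i)
    (hh : ∀ i, 0 < h i) {i j : Fin 2} (hij : j ≠ i) (h0 : (X i - (X j + w j), Y i - Y j) ∈ Λ) :
    (w j, h i) ∈ Λ ∧ (-w i, h j) ∈ Λ := by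
  have hwi := hw i
  have hwj := hw j
  have hu : (w j, h i) ∈ Λ := by
    have h1 := H.one_sub_corner hΛ hw hh hij.symm true true
    simp only [boxCorner, closedEnd, Prod.mk_sub_mk, if_true, Bool.not_true, Bool.false_eq_true,
      if_false] at h1
    rcases h1 with h1 | h1
    · have := hΛ.fst _ (mem_of_mem (p := (w i + w j, 0)) (Λ.neg_mem (Λ.add_mem h0 h1))
        (by simp; ring) (by simp))
      linarith
    · exact mem_of_mem (Λ.neg_mem (Λ.add_mem h0 h1)) (by simp) (by simp)
  refine ⟨hu, ?_⟩
  have h2 := H.one_sub_corner hΛ hw hh hij false false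
  simp only [boxCorner, closedEnd, Prod.mk_sub_mk, if_true, Bool.not_false, Bool.false_eq_true,
    if_false] at h2
  rcases h2 with h2 | h2
  · exact mem_of_mem (Λ.sub_mem hu (Λ.sub_mem h2 h0)) (by simp; ring) (by simp; ring)
  -- In this branch the widths are equal, and the upper left corner of `j` yields the second vector
  -- whichever corner of `i` it meets.
  · have h3 : (w i, h i) ∈ Λ := mem_of_mem (Λ.sub_mem h2 h0) (by simp) (by simp)
    have h4 : w j - w i = 0 := hΛ.fst _ (mem_of_mem (Λ.sub_mem hu h3) (by simp) (by simp))
    have h5 := H.one_sub_corner hΛ hw hh hij.symm true false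
    simp only [boxCorner, closedEnd, Prod.mk_sub_mk, if_true, Bool.not_false, Bool.not_true,
      Bool.false_eq_true, if_false] at h5
    rcases h5 with h5 | h5
    · refine mem_of_mem (Λ.add_mem h5 h2) ?_ ?_ <;> simp <;> linarith
    · refine mem_of_mem (Λ.add_mem h5 h0) ?_ ?_ <;> simp <;> linarith

/-- A lower left corner meets either the lower right or the upper left corner of the other box. If
both boxes were in the second case, the axis vector `(0, h 0 + h 1)` would be in `Λ`. -/
theorem exists_stair (H : IsBoxTiling Λ X Y w h) (hΛ : IsAxisFree Λ) (hw : ∀ i, 0 < w i)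
    (hh : ∀ i, 0 < h i) :
    ∃ i j : Fin 2, j ≠ i ∧ (X i - (X j + w j), Y i - Y j) ∈ Λ ∧ (w j, h i) ∈ Λ ∧
      (-w i, h j) ∈ Λ := by
  have h01 : (1 : Fin 2) ≠ 0 := by decide
  have h1 := H.one_sub_corner hΛ hw hh h01 true true
  simp only [boxCorner, closedEnd, Prod.mk_sub_mk, if_true, Bool.not_true, Bool.false_eq_true,
    if_false] at h1
  rcases h1 with h1 | h1
  · exact ⟨0, 1, h01, h1, H.stair_of_adjacent hΛ hw hh h01 h1⟩
  have h2 := H.one_sub_corner hΛ hw hh h01.symm true true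
  simp only [boxCorner, closedEnd, Prod.mk_sub_mk, if_true, Bool.not_true, Bool.false_eq_true,
    if_false] at h2
  rcases h2 with h2 | h2
  · exact ⟨1, 0, h01.symm, h2, H.stair_of_adjacent hΛ hw hh h01.symm h2⟩
  have h3 := hΛ.snd (h 0 + h 1) (mem_of_mem (Λ.neg_mem (Λ.add_mem h1 h2)) (by simp)
    (by simp; ring))
  linarith [hh 0, hh 1]

end IsBoxTiling

/-! ### Two-element quasi-Markov partitions as tilings by boxes. -/

theorem Parallelogram.exists_eq_box {e : Fin 2 → Plane} (he : IsIrrationalPair e)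
    (P : Parallelogram e) (q : Plane) (j : Fin 2) :
    ∃ x y : ℝ, P = boxParallelogram e q j 1 (lt_add_of_pos_right x (P.len_pos j))
      (lt_add_of_pos_right y (P.len_pos (1 - j))) := by
  obtain ⟨⟨x, y⟩, h⟩ :=
    framePoint_surjective (he.linearIndependent_frame j (one_ne_zero (α := ℝ))) q P.corner
  refine ⟨x, y, ?_⟩
  obtain ⟨corner, len, hlen⟩ := P
  simp only [boxParallelogram, Parallelogram.mk.injEq, add_sub_cancel_left]
  refine ⟨?_, funext fun i => ?_⟩
  · rw [min_eq_left (by linarith [hlen (1 - j)])]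
    simpa [framePoint] using h.symm
  · rcases eq_or_eq_one_sub i j with rfl | rfl <;> simp [one_sub_ne]

theorem frameLattice_coords_injective {f g : Plane} (h : LinearIndependent ℝ ![f, g]) :
    Function.Injective fun (z : ℝ × ℝ) (i : Fin 2) => z.1 * f i + z.2 * g i := by
  intro z z' hz
  refine framePoint_injective h 0 (funext fun i => ?_)
  simpa [framePoint] using congrFun hz i

theorem finite_frameLattice_inter {f g : Plane} (h : LinearIndependent ℝ ![f, g]) (M : ℝ) :
    {v : frameLattice f g | |v.1.1| ≤ M ∧ |v.1.2| ≤ M}.Finite := by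
  choose n hn using fun v : frameLattice f g => v.2
  have hinj : Function.Injective n := by
    intro v v' hv
    refine Subtype.ext (frameLattice_coords_injective h (funext fun i => ?_))
    simp only [hn, hv]
  let K : Fin 2 → ℤ := fun i => ⌈M * |f i| + M * |g i|⌉
  refine Set.Finite.of_injOn (f := n) (t := Icc (-K) K) ?_ hinj.injOn (finite_Icc _ _)
  rintro v ⟨h1, h2⟩
  have hb : ∀ i, |(n v i : ℝ)| ≤ K i := by
    intro i
    rw [← hn v i]
    calc _ ≤ |v.1.1 * f i| + |v.1.2 * g i| := abs_add_le _ _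
      _ ≤ M * |f i| + M * |g i| := by rw [abs_mul, abs_mul]; gcongr
      _ ≤ _ := Int.le_ceil _
  constructor <;> intro i <;> have := abs_le.1 (hb i)
  · have := this.1
    simp only [Pi.neg_apply]
    exact_mod_cast this
  · exact_mod_cast this.2

theorem countable_frameLattice {f g : Plane} (h : LinearIndependent ℝ ![f, g]) :
    Countable (frameLattice f g) := by
  choose n hn using fun v : frameLattice f g => v.2
  have hinj : Function.Injective n := by
    intro v v' hv
    refine Subtype.ext (frameLattice_coords_injective h (funext fun i => ?_))
    simp only [hn, hv]
  exact hinj.countable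

theorem inwardSign_ne_zero (σ : Bool) : inwardSign σ ≠ 0 := by
  cases σ <;> simp [inwardSign]

/-- A leaf arc is met at countably many parameters by an oblique line. -/
theorem IsLeafArc.countable_oblique {e : Fin 2 → Plane} (he : IsIrrationalPair e) {q : Plane}
    {S : Set Torus} (hS : IsLeafArc e S) (x y : ℝ) {c d : ℝ} (hc : c ≠ 0) (hd : d ≠ 0) :
    {ε : ℝ | frameProj q (e 0) ((1 : ℝ) • e (1 - 0)) (x + c * ε, y + d * ε) ∈ S}.Countable := by
  have hind := he.linearIndependent_frame 0 (one_ne_zero (α := ℝ))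
  have := countable_frameLattice hind
  obtain ⟨j, q', a, -, rfl⟩ := hS
  obtain ⟨⟨x', y'⟩, rfl⟩ := framePoint_surjective hind q q'
  rcases eq_or_eq_one_sub j 0 with rfl | rfl
  · refine (countable_range fun v : frameLattice (e 0) ((1 : ℝ) • e (1 - 0)) =>
      (y' - y - v.1.2) / d).mono ?_
    rintro ε ⟨s, -, hs⟩
    have hs' : frameProj q (e 0) ((1 : ℝ) • e (1 - 0)) (x' + s, y') =
        frameProj q (e 0) ((1 : ℝ) • e (1 - 0)) (x + c * ε, y + d * ε) := by
      rw [← hs]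
      refine congrArg torusProj ?_
      simp only [framePoint]
      module
    refine ⟨⟨_, frameProj_eq_iff.1 hs'.symm⟩, ?_⟩
    simp only [Prod.mk_sub_mk]
    field_simp
    ring
  · refine (countable_range fun v : frameLattice (e 0) ((1 : ℝ) • e (1 - 0)) =>
      (x' - x - v.1.1) / c).mono ?_
    rintro ε ⟨s, -, hs⟩
    have hs' : frameProj q (e 0) ((1 : ℝ) • e (1 - 0)) (x', y' + s) =
        frameProj q (e 0) ((1 : ℝ) • e (1 - 0)) (x + c * ε, y + d * ε) := by
      rw [← hs]
      refine congrArg torusProj ?_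
      simp only [framePoint]
      module
    refine ⟨⟨_, frameProj_eq_iff.1 hs'.symm⟩, ?_⟩
    simp only [Prod.mk_sub_mk]
    field_simp
    ring

section Tiling

variable {e : Fin 2 → Plane} {q : Plane} {X Y w h : Fin 2 → ℝ}

/-- If a point were in no half-open box, a short oblique segment from it would miss all open boxes,
hence project into finitely many leaf arcs, each of which it meets only countably often. Two boxes
at one point would overlap in their interiors. -/
theorem isBoxTiling_of_isQuasiMarkovPartition (he : IsIrrationalPair e) (hw : ∀ i, 0 < w i)
    (hh : ∀ i, 0 < h i)
    (hR : IsQuasiMarkovPartition e fun i => boxParallelogram e q 0 1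
      (lt_add_of_pos_right (X i) (hw i)) (lt_add_of_pos_right (Y i) (hh i))) :
    IsBoxTiling (frameLattice (e 0) ((1 : ℝ) • e (1 - 0))) X Y w h := by
  have hind := he.linearIndependent_frame 0 (one_ne_zero (α := ℝ))
  intro σ τ x y
  apply existsUnique_of_exists_of_unique
  · by_contra! hno
    -- Any translate that contains a point within distance `1` of `(x, y)` in each coordinate has
    -- its translation vector bounded by `M`. Only finitely many translates matter, so a common
    -- small `ε` exists.
    let M : ℝ := ∑ i, (|X i| + |Y i| + w i + h i) + |x| + |y| + 1
    have hfin := (finite_univ (α := Fin 2)).prod (finite_frameLattice_inter hind M)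
    have hev : ∀ᶠ ε in nhdsWithin (0 : ℝ) (Ioi 0),
        ∀ k ∈ (univ : Set (Fin 2)) ×ˢ {v : frameLattice (e 0) ((1 : ℝ) • e (1 - 0)) |
          |v.1.1| ≤ M ∧ |v.1.2| ≤ M},
        ¬ (x + inwardSign σ * ε ∈ Ioo (X k.1 + k.2.1.1) (X k.1 + w k.1 + k.2.1.1) ∧
          y + inwardSign τ * ε ∈ Ioo (Y k.1 + k.2.1.2) (Y k.1 + h k.1 + k.2.1.2)) := by
      rw [Filter.eventually_all_finite hfin]
      intro k _
      by_cases h1 : HalfOpen σ (X k.1 + k.2.1.1) (X k.1 + w k.1 + k.2.1.1) x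
      · filter_upwards [eventually_notMem_of_not_halfOpen (hno k h1)] with ε hε h2
        exact hε h2.2
      · filter_upwards [eventually_notMem_of_not_halfOpen h1] with ε hε h2
        exact hε h2.1
    obtain ⟨δ, hδ, hsub⟩ := (mem_nhdsGT_iff_exists_Ioo_subset).1
      (Filter.inter_mem hev (Ioo_mem_nhdsGT (zero_lt_one (α := ℝ))))
    obtain ⟨F, hF, hFarc, hFeq⟩ := hR.complement
    have hcount : (⋃ S ∈ F, {ε : ℝ | frameProj q (e 0) ((1 : ℝ) • e (1 - 0))
        (x + inwardSign σ * ε, y + inwardSign τ * ε) ∈ S}).Countable :=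
      hF.countable.biUnion fun S hS => (hFarc S hS).countable_oblique he x y
        (inwardSign_ne_zero σ) (inwardSign_ne_zero τ)
    refine absurd (Cardinal.Real.Ioo_countable_iff.1 (hcount.mono fun ε hε => ?_)) (not_le.2 hδ)
    obtain ⟨h1, h2⟩ := hsub hε
    have hcompl : frameProj q (e 0) ((1 : ℝ) • e (1 - 0))
        (x + inwardSign σ * ε, y + inwardSign τ * ε) ∈ ⋃₀ F := by
      rw [← hFeq]
      intro hmem
      obtain ⟨i, hi⟩ := mem_iUnion.1 hmem
      rw [boxParallelogram_torusInner _ _ (Or.inl rfl)] at hi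
      obtain ⟨⟨x', y'⟩, ⟨hx', hy'⟩, he'⟩ := hi
      have hv := frameProj_eq_iff.1 he'
      simp only [Prod.mk_sub_mk] at hv
      have hM : |X i| + |Y i| + w i + h i ≤ ∑ i, (|X i| + |Y i| + w i + h i) :=
        Finset.single_le_sum (f := fun i => |X i| + |Y i| + w i + h i)
          (fun i _ => by have := hw i; have := hh i; positivity) (Finset.mem_univ i)
      have habs : ∀ (σ : Bool), |inwardSign σ * ε| ≤ 1 := by
        intro σ
        have : |inwardSign σ| = 1 := by cases σ <;> simp [inwardSign]
        rw [abs_mul, this, one_mul, abs_of_pos h2.1]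
        exact h2.2.le
      have a1 := abs_le.1 (habs σ)
      have a2 := abs_le.1 (habs τ)
      have b1 := hx'.1
      have b2 := hx'.2
      have b3 := hy'.1
      have b4 := hy'.2
      have c1 := neg_abs_le (X i)
      have c2 := le_abs_self (X i)
      have c3 := neg_abs_le (Y i)
      have c4 := le_abs_self (Y i)
      have c5 := neg_abs_le x
      have c6 := le_abs_self x
      have c7 := neg_abs_le y
      have c8 := le_abs_self y
      have d1 := hw i
      have d2 := hh i
      refine h1 (i, ⟨_, hv⟩) ⟨mem_univ _, ?_, ?_⟩ ⟨?_, ?_⟩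
      · rw [abs_le]; constructor <;> simp only [M] <;> linarith
      · rw [abs_le]; constructor <;> simp only [M] <;> linarith
      · constructor <;> simp only <;> linarith
      · constructor <;> simp only <;> linarith
    obtain ⟨S, hS, hmem⟩ := hcompl
    exact mem_biUnion hS hmem
  · rintro ⟨i, v⟩ ⟨i', v'⟩ ⟨h1, h2⟩ ⟨h1', h2'⟩
    -- One nudge moves the point into the interiors of both boxes.
    obtain ⟨ε, ⟨e1, e2⟩, e1', e2'⟩ := ((h1.eventually.and h2.eventually).and
      (h1'.eventually.and h2'.eventually)).exists
    set z : ℝ × ℝ := (x + inwardSign σ * ε, y + inwardSign τ * ε) with hz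
    have key : ∀ (i : Fin 2) (v : frameLattice (e 0) ((1 : ℝ) • e (1 - 0))),
        z.1 ∈ Ioo (X i + v.1.1) (X i + w i + v.1.1) →
        z.2 ∈ Ioo (Y i + v.1.2) (Y i + h i + v.1.2) →
        framePoint q (e 0) ((1 : ℝ) • e (1 - 0)) (z - v.1) ∈ (boxParallelogram e q 0 1
          (lt_add_of_pos_right (X i) (hw i)) (lt_add_of_pos_right (Y i) (hh i))).inner := by
      intro i v h1 h2
      rw [boxParallelogram_inner _ _ (Or.inl rfl)]
      refine mem_image_of_mem _ ⟨⟨?_, ?_⟩, ?_, ?_⟩ <;>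
        simp only [Prod.fst_sub, Prod.snd_sub] <;> linarith [h1.1, h1.2, h2.1, h2.2]
    have m1 := key i v e1 e2
    have m2 := key i' v' e1' e2'
    have heq : frameProj q (e 0) ((1 : ℝ) • e (1 - 0)) (z - v.1) =
        frameProj q (e 0) ((1 : ℝ) • e (1 - 0)) (z - v'.1) := by
      rw [frameProj_eq_iff]
      simpa using AddSubgroup.sub_mem _ v.2 v'.2
    have hii : i = i' := by
      by_contra hne
      exact (Set.disjoint_left.1 (hR.disjoint i i' hne)) ⟨_, m1, rfl⟩ ⟨_, m2, heq.symm⟩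
    subst hii
    have := framePoint_injective hind q (hR.injOn i m1 m2 heq)
    simp only [sub_right_inj] at this
    rw [Subtype.ext this]

end Tiling

/-! ### From a tiling by two boxes back to a T-configuration. -/

theorem torusProj_leg_eq_iff {e : Fin 2 → Plane} {q : Plane} {j : Fin 2} {σ x y : ℝ} :
    torusProj (q + (σ * y) • e (1 - j)) = torusProj (q + x • e j) ↔
      (-x, y) ∈ frameLattice (e j) (σ • e (1 - j)) := by
  have h1 : torusProj (q + (σ * y) • e (1 - j)) =
      frameProj q (e j) (σ • e (1 - j)) (0, y) := by
    simp [frameProj, framePoint, smul_smul, mul_comm]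
  have h2 : torusProj (q + x • e j) = frameProj q (e j) (σ • e (1 - j)) (x, 0) := by
    simp [frameProj, framePoint]
  rw [h1, h2, eq_comm, frameProj_eq_iff, Prod.mk_sub_mk, zero_sub, sub_zero]

namespace TConfiguration

variable {e : Fin 2 → Plane} {j : Fin 2} {a b s t : ℝ}

/-- The T-configuration given by a stair basis. -/
def ofStairBasis (q : Plane)
    (h : IsStairBasis (frameLattice (e j) ((1 : ℝ) • e (1 - j))) a b s t) (hst : s ≠ t) :
    TConfiguration e where
  base := q
  bar := j
  sign := 1
  sign_eq := Or.inl rfl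
  lo := -a
  hi := b
  lo_neg := neg_lt_zero.2 h.a_pos
  hi_pos := h.b_pos
  tA := min s t
  tB := max s t
  tA_pos := lt_min h.s_pos h.t_pos
  tA_lt_tB := min_lt_max.2 hst
  endpoints := by
    simp only [torusProj_leg_eq_iff, neg_neg]
    rcases le_total s t with hle | hle
    · rw [min_eq_left hle, max_eq_right hle]
      exact Or.inl ⟨h.right_mem, h.left_mem⟩
    · rw [min_eq_right hle, max_eq_left hle]
      exact Or.inr ⟨h.left_mem, h.right_mem⟩
  avoids := by
    rintro y hy0 hy1 hy2 ⟨x, hx, hxy⟩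
    have hs := h.s_pos
    have ht := h.t_pos
    have hmax : max s t ≤ s + t := max_le (by linarith) (by linarith)
    have := h.height_of_mem (torusProj_leg_eq_iff.1 hxy.symm)
      ⟨by linarith [hx.2], by linarith [hx.1]⟩ hy0.le (hy1.le.trans hmax)
    simp only [Prod.mk.injEq] at this
    rcases this with h1 | h1 | h1 | h1 <;> rcases le_total s t with hle | hle <;>
      simp only [hle, min_eq_left, max_eq_right, min_eq_right, max_eq_left] at hy1 hy2 <;>
      first
      | exact hy2 h1.2
      | linarith [h1.2]

theorem ofStairBasis_isStair (q : Plane)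
    (h : IsStairBasis (frameLattice (e j) ((1 : ℝ) • e (1 - j))) a b s t) (hst : s ≠ t) :
    (ofStairBasis q h hst).IsStair s t where
  basis := by
    change IsStairBasis (frameLattice (e j) ((1 : ℝ) • e (1 - j))) (- -a) b s t
    rwa [neg_neg]
  heights := by
    change (s = min s t ∧ t = max s t) ∨ (s = max s t ∧ t = min s t)
    rcases le_total s t with hle | hle <;> simp [hle]

end TConfiguration

/-- Translate the lower left corner of box `i` by a lattice vector in the L-shape. It lies in box
`i` or in the copy of box `j` to its left, but it is also the corner of a translate of box `i`;
uniqueness of the tile forces the vector to be zero. -/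
theorem IsBoxTiling.isStairBasis {Λ : AddSubgroup (ℝ × ℝ)} {X Y w h : Fin 2 → ℝ}
    (H : IsBoxTiling Λ X Y w h) (hw : ∀ i, 0 < w i) (hh : ∀ i, 0 < h i) {i j : Fin 2}
    (hij : j ≠ i) (h0 : (X i - (X j + w j), Y i - Y j) ∈ Λ) (hu : (w j, h i) ∈ Λ)
    (hv : (-w i, h j) ∈ Λ) : IsStairBasis Λ (w j) (w i) (h i) (h j) := by
  refine .of_no_return (hw j) (hw i) (hh i) (hh j) hu hv ?_
  intro x y hmem hxy
  have h1 : ∀ k : Fin 2 × Λ,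
      HalfOpen true (X k.1 + k.2.1.1) (X k.1 + w k.1 + k.2.1.1) (X i + x) →
      HalfOpen true (Y k.1 + k.2.1.2) (Y k.1 + h k.1 + k.2.1.2) (Y i + y) →
      k = (i, ⟨_, hmem⟩) := by
    intro k hk1 hk2
    refine (H true true (X i + x) (Y i + y)).unique ⟨hk1, hk2⟩ ⟨?_, ?_⟩ <;>
      simp only [HalfOpen, if_true] <;> constructor <;> linarith [hw i, hh i]
  rcases hxy with ⟨hx, hy⟩ | ⟨hx, hy⟩
  · have := h1 (i, 0) (by simp [HalfOpen, hx.1, hx.2]) (by simp [HalfOpen, hy.1, hy.2])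
    simp only [Prod.mk.injEq, true_and] at this
    have h2 := congrArg Subtype.val this
    simp only [ZeroMemClass.coe_zero, Prod.zero_eq_mk, Prod.mk.injEq] at h2
    exact ⟨h2.1.symm, h2.2.symm⟩
  · have := h1 (j, ⟨_, h0⟩)
      (by simp only [HalfOpen, if_true]; constructor <;> linarith [hx.1, hx.2])
      (by simp only [HalfOpen, if_true]; constructor <;> linarith [hy.1, hy.2])
    exact absurd (congrArg Prod.fst this) hij

theorem exists_tConfiguration_of_isQuasiMarkovPartition {e : Fin 2 → Plane}
    (he : IsIrrationalPair e) {R : Fin 2 → Parallelogram e} (hR : IsQuasiMarkovPartition e R) :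
    ∃ (T : TConfiguration e) (c : ℝ), T.IsNextHit c ∧ T.CutsInto c R := by
  choose X Y hXY using fun i => (R i).exists_eq_box he 0 0
  set w : Fin 2 → ℝ := fun i => (R i).len 0
  set h : Fin 2 → ℝ := fun i => (R i).len (1 - 0)
  have hw : ∀ i, 0 < w i := fun i => (R i).len_pos 0
  have hh : ∀ i, 0 < h i := fun i => (R i).len_pos (1 - 0)
  have hΛ := he.isAxisFree 0 (one_ne_zero (α := ℝ))
  have H : IsBoxTiling (frameLattice (e 0) ((1 : ℝ) • e (1 - 0))) X Y w h := by
    refine isBoxTiling_of_isQuasiMarkovPartition (q := 0) he hw hh ?_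
    convert hR using 2 with i
    exact (hXY i).symm
  have hinner : ∀ i, (R i).torusInner = frameProj 0 (e 0) ((1 : ℝ) • e (1 - 0)) ''
      (Ioo (X i) (X i + w i) ×ˢ Ioo (Y i) (Y i + h i)) := by
    intro i
    rw [← boxParallelogram_torusInner (lt_add_of_pos_right (X i) (hw i))
      (lt_add_of_pos_right (Y i) (hh i)) (Or.inl rfl)]
    exact congrArg _ (hXY i)
  clear_value w h
  obtain ⟨i, j, hij, h0, hu, hv⟩ := H.exists_stair hΛ hw hh
  have hB := H.isStairBasis hw hh hij h0 hu hv
  -- The hit times `tA < tB` must differ; equal heights would put `(w j + w i, 0)` in the lattice.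
  have hne : h i ≠ h j := by
    intro heq
    have := hΛ.fst (w j + w i)
      (IsBoxTiling.mem_of_mem (AddSubgroup.sub_mem _ hu hv) (by simp) (by simp [heq]))
    linarith [hw i, hw j]
  -- The initial point is the lower left corner of box `i`, the concave side of the crossbar being
  -- irrelevant: the leg rises between the two boxes.
  set q : Plane := framePoint 0 (e 0) ((1 : ℝ) • e (1 - 0)) (X i, Y i) with hq
  have hT := TConfiguration.ofStairBasis_isStair q hB hne
  refine ⟨_, _, hT.isNextHit, hR, ?_⟩
  rw [hT.compl_eq he]
  have hproj : ∀ z : ℝ × ℝ, (TConfiguration.ofStairBasis q hB hne).proj z =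
      frameProj 0 (e 0) ((1 : ℝ) • e (1 - 0)) (X i + z.1, Y i + z.2) := by
    intro z
    change frameProj q (e 0) ((1 : ℝ) • e (1 - 0)) z = _
    refine congrArg torusProj ?_
    simp only [framePoint, hq]
    module
  change _ '' IsStairBasis.boxes (- -w j) (w i) (h i) (h j) = _
  rw [neg_neg]
  ext p
  simp only [mem_iUnion, hinner]
  constructor
  · rintro ⟨z, ⟨hz1, hz2⟩ | ⟨hz1, hz2⟩, rfl⟩ <;> rw [hproj]
    · refine ⟨i, _, ⟨⟨?_, ?_⟩, ?_, ?_⟩, rfl⟩ <;> simp only <;>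
        linarith [hz1.1, hz1.2, hz2.1, hz2.2]
    · refine ⟨j, (X i + z.1 - (X i - (X j + w j)), Y i + z.2 - (Y i - Y j)),
        ⟨⟨?_, ?_⟩, ?_, ?_⟩, ?_⟩
      iterate 4 simp only; linarith [hz1.1, hz1.2, hz2.1, hz2.2]
      rw [frameProj_eq_iff]
      convert h0 using 1
      ext <;> simp <;> ring
  · rintro ⟨k, ⟨x, y⟩, ⟨hx, hy⟩, rfl⟩
    simp only at hx hy
    by_cases hk : k = i
    · subst hk
      refine ⟨(x - X k, y - Y k), Or.inl ⟨⟨?_, ?_⟩, ?_, ?_⟩, ?_⟩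
      iterate 4 simp only; linarith [hx.1, hx.2, hy.1, hy.2]
      rw [hproj]
      simp
    · obtain rfl : k = j := by omega
      refine ⟨(x - (X k + w k), y - Y k), Or.inr ⟨⟨?_, ?_⟩, ?_, ?_⟩, ?_⟩
      iterate 4 simp only; linarith [hx.1, hx.2, hy.1, hy.2]
      rw [hproj, frameProj_eq_iff]
      refine IsBoxTiling.mem_of_mem (AddSubgroup.neg_mem _ h0) ?_ ?_ <;> simp <;> ring

/-! ### Uniqueness of the parallelograms up to integer translations. -/

theorem torusProj_add (x y : Plane) : torusProj (x + y) = torusProj x + torusProj y := by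
  funext i
  simp [torusProj]

theorem torusArc_congr {v q q' : Plane} (h : torusProj q = torusProj q') (a b : ℝ) :
    torusArc v q a b = torusArc v q' a b := by
  simp only [torusArc, torusProj_add, h]

/-- Uniqueness determines a planar parallelogram only modulo integer translations; its sides in the
torus do not depend on the lift. -/
theorem Parallelogram.isSide_congr {e : Fin 2 → Plane} {P P' : Parallelogram e}
    (hc : torusProj P.corner = torusProj P'.corner) (hl : P.len = P'.len) (j : Fin 2)
    (S : Set Torus) : P.IsSide j S ↔ P'.IsSide j S := by
  simp only [Parallelogram.IsSide, hl]
  refine exists_congr fun c => and_congr_right fun _ => ?_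
  rw [torusArc_congr (q' := P'.corner + c • e (1 - j))
    (by rw [torusProj_add, torusProj_add, hc])]

section Uniqueness

variable {e : Fin 2 → Plane} {f g q : Plane}

/-- A connected open box that projects into a disjoint union of injectively projected open sets
lies in a translate of one of them. -/
theorem exists_translate_of_image_subset {V : Set (ℝ × ℝ)} (hV : IsPreconnected V)
    (hne : V.Nonempty) {W : Fin 2 → Set (ℝ × ℝ)} (hW : ∀ i, IsOpen (W i))
    (hinj : ∀ i, InjOn (frameProj q f g) (W i))
    (hdisj : ∀ i i', i ≠ i' → Disjoint (frameProj q f g '' W i) (frameProj q f g '' W i'))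
    (hsub : frameProj q f g '' V ⊆ ⋃ i, frameProj q f g '' W i) :
    ∃ i, ∃ v ∈ frameLattice f g, ∀ z ∈ V, z - v ∈ W i := by
  let U : Fin 2 × frameLattice f g → Set (ℝ × ℝ) := fun k => {z | z - k.2.1 ∈ W k.1}
  have hU : ∀ k, IsOpen (U k) := fun k => (hW k.1).preimage (by fun_prop)
  have hcov : ∀ z ∈ V, ∃ k, z ∈ U k := by
    intro z hz
    obtain ⟨i, z', hz', h⟩ := mem_iUnion.1 (hsub (mem_image_of_mem _ hz))
    exact ⟨(i, ⟨z - z', frameProj_eq_iff.1 h⟩), by simpa [U] using hz'⟩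
  have huniq : ∀ z k k', z ∈ U k → z ∈ U k' → k = k' := by
    rintro z ⟨i, v⟩ ⟨i', v'⟩ h h'
    have heq : frameProj q f g (z - v.1) = frameProj q f g (z - v'.1) := by
      rw [frameProj_eq_iff]
      simpa using AddSubgroup.sub_mem _ v.2 v'.2
    have hii : i = i' := by
      by_contra hne
      exact Set.disjoint_left.1 (hdisj i i' hne) ⟨_, h, rfl⟩ ⟨_, h', heq.symm⟩
    subst hii
    have := hinj i h h' heq
    rw [sub_right_inj] at this
    exact Prod.ext rfl (Subtype.ext this)
  obtain ⟨z₀, hz₀⟩ := hne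
  obtain ⟨k, hk⟩ := hcov z₀ hz₀
  have hmain : V ⊆ U k := by
    refine hV.subset_left_of_subset_union (v := ⋃ k' ∈ {k' | k' ≠ k}, U k') (hU k)
      (isOpen_biUnion fun k' _ => hU k') ?_ ?_ ⟨z₀, hz₀, hk⟩
    · rw [Set.disjoint_left]
      intro z hz hz'
      obtain ⟨k', hk', hz'⟩ := mem_iUnion₂.1 hz'
      exact hk' (huniq z k' k hz' hz)
    · intro z hz
      obtain ⟨k', hk'⟩ := hcov z hz
      by_cases h : k' = k
      · exact Or.inl (h ▸ hk')
      · exact Or.inr (mem_iUnion₂.2 ⟨k', h, hk'⟩)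
  exact ⟨k.1, k.2.1, k.2.2, hmain⟩

theorem boxParallelogram_corner {j : Fin 2} {x₀ x₁ y₀ y₁ : ℝ} (hx : x₀ < x₁) (hy : y₀ < y₁) :
    (boxParallelogram e q j 1 hx hy).corner =
      framePoint q (e j) ((1 : ℝ) • e (1 - j)) (x₀, y₀) := by
  simp [boxParallelogram, framePoint, min_eq_left hy.le]

theorem le_of_forall_mem_Ioo {l r l' r' c : ℝ} (h : l < r)
    (hsub : ∀ x ∈ Ioo l r, x - c ∈ Ioo l' r') : l' + c ≤ l ∧ r ≤ r' + c := by
  have : Ioo l r ⊆ Ioo (l' + c) (r' + c) := fun x hx => by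
    have := hsub x hx
    constructor <;> linarith [this.1, this.2]
  exact (Ioo_subset_Ioo_iff h).1 this

/-- Two partitions into parallelograms with the same union of the interiors have the same elements,
up to integer translations. -/
theorem exists_corner_eq_and_len_eq (he : IsIrrationalPair e) {R R' : Fin 2 → Parallelogram e}
    (hR : IsQuasiMarkovPartition e R) (hR' : IsQuasiMarkovPartition e R')
    (hU : ⋃ i, (R i).torusInner = ⋃ i, (R' i).torusInner) (i : Fin 2) :
    ∃ i', torusProj (R i).corner = torusProj (R' i').corner ∧ (R i).len = (R' i').len := by
  have hind := he.linearIndependent_frame 0 (one_ne_zero (α := ℝ))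
  have data : ∀ P : Parallelogram e, ∃ x y : ℝ,
      P.corner = framePoint 0 (e 0) ((1 : ℝ) • e (1 - 0)) (x, y) ∧
      P.inner = framePoint 0 (e 0) ((1 : ℝ) • e (1 - 0)) ''
        (Ioo x (x + P.len 0) ×ˢ Ioo y (y + P.len (1 - 0))) := by
    intro P
    obtain ⟨x, y, h⟩ := P.exists_eq_box he 0 0
    refine ⟨x, y, ?_, ?_⟩
    · rw [← boxParallelogram_corner (lt_add_of_pos_right x (P.len_pos 0))
        (lt_add_of_pos_right y (P.len_pos (1 - 0)))]
      exact congrArg Parallelogram.corner h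
    · rw [← boxParallelogram_inner (lt_add_of_pos_right x (P.len_pos 0))
        (lt_add_of_pos_right y (P.len_pos (1 - 0))) (Or.inl rfl)]
      exact congrArg Parallelogram.inner h
  choose x y hcorner hinner using data
  let V : Parallelogram e → Set (ℝ × ℝ) := fun P =>
    Ioo (x P) (x P + P.len 0) ×ˢ Ioo (y P) (y P + P.len (1 - 0))
  have hVpre : ∀ P, IsPreconnected (V P) := fun P => isPreconnected_Ioo.prod isPreconnected_Ioo
  have hVopen : ∀ P, IsOpen (V P) := fun P => isOpen_Ioo.prod isOpen_Ioo
  have hVne : ∀ P, (V P).Nonempty := fun P =>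
    (nonempty_Ioo.2 (lt_add_of_pos_right _ (P.len_pos _))).prod
      (nonempty_Ioo.2 (lt_add_of_pos_right _ (P.len_pos _)))
  have htor : ∀ P : Parallelogram e, P.torusInner =
      frameProj 0 (e 0) ((1 : ℝ) • e (1 - 0)) '' V P := by
    intro P
    rw [Parallelogram.torusInner, hinner, image_image]
    rfl
  have hinj : ∀ {R : Fin 2 → Parallelogram e}, IsQuasiMarkovPartition e R → ∀ i,
      InjOn (frameProj 0 (e 0) ((1 : ℝ) • e (1 - 0))) (V (R i)) := by
    intro R hR i z hz z' hz' heq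
    refine framePoint_injective hind 0 (hR.injOn i ?_ ?_ heq) <;> rw [hinner]
    exacts [mem_image_of_mem _ hz, mem_image_of_mem _ hz']
  have step : ∀ {R R' : Fin 2 → Parallelogram e}, IsQuasiMarkovPartition e R' →
      ⋃ i, (R i).torusInner = ⋃ i, (R' i).torusInner → ∀ i,
      ∃ i', ∃ v ∈ frameLattice (e 0) ((1 : ℝ) • e (1 - 0)), ∀ z ∈ V (R i), z - v ∈ V (R' i') := by
    intro R R' hR' hU i
    refine exists_translate_of_image_subset (q := 0) (hVpre _) (hVne _) (fun i => hVopen _)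
      (hinj hR') (fun i i' hii => ?_) ?_
    · rw [← htor, ← htor]
      exact hR'.disjoint i i' hii
    · simp only [← htor, ← hU]
      exact subset_iUnion (fun i => (R i).torusInner) i
  obtain ⟨i', v, hv, h1⟩ := step hR' hU i
  -- Going back must return to the original element with the inverse translation, because the
  -- interiors are disjoint and project injectively. The two inclusions are then equalities.
  obtain ⟨i'', v', hv', h2⟩ := step hR hU.symm i'
  obtain ⟨z, hz⟩ := hVne (R i)
  have h3 := h2 _ (h1 z hz)
  have heq : frameProj 0 (e 0) ((1 : ℝ) • e (1 - 0)) (z - v - v') =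
      frameProj 0 (e 0) ((1 : ℝ) • e (1 - 0)) z := by
    rw [frameProj_eq_iff]
    convert AddSubgroup.add_mem _ hv hv' using 1
    abel
  have hii : i'' = i := by
    by_contra hne
    have hd := hR.disjoint i'' i hne
    rw [htor, htor] at hd
    exact Set.disjoint_left.1 hd ⟨_, h3, heq⟩ ⟨_, hz, rfl⟩
  subst hii
  have hvv := hinj hR _ h3 hz heq
  rw [sub_sub, sub_eq_self] at hvv
  obtain rfl : v' = -v := (neg_eq_of_add_eq_zero_right hvv).symm
  have hsplit : ∀ {P P' : Parallelogram e} {v : ℝ × ℝ}, (∀ z ∈ V P, z - v ∈ V P') →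
      (x P' + v.1 ≤ x P ∧ x P + P.len 0 ≤ x P' + P'.len 0 + v.1) ∧
      (y P' + v.2 ≤ y P ∧ y P + P.len (1 - 0) ≤ y P' + P'.len (1 - 0) + v.2) := by
    intro P P' v h
    obtain ⟨z, hz⟩ := hVne P
    exact ⟨le_of_forall_mem_Ioo (lt_add_of_pos_right _ (P.len_pos _)) fun u hu =>
        (h (u, z.2) ⟨hu, hz.2⟩).1,
      le_of_forall_mem_Ioo (lt_add_of_pos_right _ (P.len_pos _)) fun u hu =>
        (h (z.1, u) ⟨hz.1, hu⟩).2⟩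
  obtain ⟨⟨a1, a2⟩, a3, a4⟩ := hsplit h1
  obtain ⟨⟨b1, b2⟩, b3, b4⟩ := hsplit h2
  simp only [Prod.fst_neg, Prod.snd_neg] at b1 b2 b3 b4
  refine ⟨i', ?_, funext ((forall_iff_and_one_sub 0 _).2 ⟨by linarith, by linarith⟩)⟩
  rw [hcorner, hcorner]
  change frameProj 0 _ _ _ = frameProj 0 _ _ _
  rw [frameProj_eq_iff]
  refine IsBoxTiling.mem_of_mem (AddSubgroup.neg_mem _ hv) ?_ ?_ <;> simp <;> linarith

end Uniqueness

/-! ### Hyperbolic automorphisms: eigenlines and diagonal action. -/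

theorem realMatrix_inv_mul (A : GL (Fin 2) ℤ) : realMatrix A⁻¹ * realMatrix A = 1 := by
  have h : ((A⁻¹ : GL (Fin 2) ℤ) : Matrix (Fin 2) (Fin 2) ℤ) * (A : Matrix (Fin 2) (Fin 2) ℤ) = 1 :=
    Units.inv_mul A
  have h2 := congrArg (fun M => M.map (Int.castRingHom ℝ)) h
  simp only [Matrix.map_mul, Matrix.map_one _ (map_zero _) (map_one _)] at h2
  exact h2

theorem toralAut_injective (A : GL (Fin 2) ℤ) : Function.Injective (toralAut A) := by
  refine Function.LeftInverse.injective (g := toralAut A⁻¹) fun p => ?_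
  obtain ⟨x, rfl⟩ := torusProj_surjective p
  rw [toralAut_torusProj, toralAut_torusProj, Matrix.mulVec_mulVec, realMatrix_inv_mul,
    Matrix.one_mulVec]

/-- A primitive integer eigenvector of an element of `GL(2, ℤ)` has eigenvalue `±1`. -/
theorem abs_eq_one_of_primitive_eigenvector (A : GL (Fin 2) ℤ) {n x : Fin 2 → ℤ}
    (hx : ∑ i, x i * n i = 1) {c : ℝ}
    (h : (realMatrix A).mulVec (fun i => (n i : ℝ)) = c • fun i => (n i : ℝ)) : |c| = 1 := by
  have hx' : ∑ i, (x i : ℝ) * n i = 1 := by exact_mod_cast hx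
  -- Since `x · n = 1`, pairing `x` with `A n` shows that the eigenvalue is an integer. The same
  -- pairing with `A⁻¹ n` makes it a unit.
  obtain ⟨k, rfl⟩ : ∃ k : ℤ, c = k := by
    refine ⟨∑ i, x i * ∑ j, (A : Matrix (Fin 2) (Fin 2) ℤ) i j * n j, ?_⟩
    push_cast
    have h1 : ∀ i, ∑ j, ((A : Matrix (Fin 2) (Fin 2) ℤ) i j : ℝ) * n j = c * n i := fun i =>
      congrFun h i
    simp only [h1, mul_left_comm _ c, ← Finset.mul_sum, hx', mul_one]
  have h2 : (fun i => (n i : ℝ)) = (k : ℝ) • (realMatrix A⁻¹).mulVec (fun i => (n i : ℝ)) := by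
    rw [← Matrix.mulVec_smul, ← h, Matrix.mulVec_mulVec, realMatrix_inv_mul, Matrix.one_mulVec]
  have h3 : k * ∑ i, x i * ∑ j, ((A⁻¹ : GL (Fin 2) ℤ) : Matrix (Fin 2) (Fin 2) ℤ) i j * n j = 1 := by
    have h4 : ∀ i, (n i : ℝ) =
        k * ∑ j, (((A⁻¹ : GL (Fin 2) ℤ) : Matrix (Fin 2) (Fin 2) ℤ) i j : ℝ) * n j := fun i =>
      congrFun h2 i
    have h5 : ∀ i, n i =
        k * ∑ j, ((A⁻¹ : GL (Fin 2) ℤ) : Matrix (Fin 2) (Fin 2) ℤ) i j * n j := fun i => by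
      exact_mod_cast h4 i
    rw [Finset.mul_sum, ← hx]
    refine Finset.sum_congr rfl fun i _ => ?_
    rw [mul_left_comm, ← h5 i]
  have h6 : |k| = 1 := Int.isUnit_iff_abs_eq.1 (IsUnit.of_mul_eq_one _ h3)
  exact_mod_cast h6

/-- On a vertical line or a line of rational slope, the eigenvector would be a multiple of a
primitive integer vector, with eigenvalue `±1`. -/
theorem irrationalSlope_of_eigenvector (A : GL (Fin 2) ℤ) {v : Plane} (hv : v ≠ 0) {c : ℝ}
    (hc : |c| ≠ 1) (h : (realMatrix A).mulVec v = c • v) : IrrationalSlope v := by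
  have key : ∀ (r : ℝ) (n x : Fin 2 → ℤ), r ≠ 0 → ∑ i, x i * n i = 1 →
      v = r • (fun i => (n i : ℝ)) → False := by
    intro r n x hr hx hvn
    refine hc (abs_eq_one_of_primitive_eigenvector A hx ?_)
    rw [hvn, Matrix.mulVec_smul, smul_comm] at h
    exact smul_right_injective _ hr h
  by_cases h0 : v 0 = 0
  · exfalso
    refine key (v 1) ![0, 1] ![0, 1] (fun h1 => hv ?_) (by simp) ?_
    · ext i; fin_cases i <;> simpa
    · ext i; fin_cases i <;> simp [h0]
  refine ⟨h0, ?_⟩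
  rintro ⟨ρ, hρ⟩
  obtain ⟨x, y, hxy⟩ := (Int.isCoprime_iff_gcd_eq_one (m := ρ.num) (n := ρ.den)).2 ρ.reduced
  have hd : (ρ.den : ℝ) ≠ 0 := by exact_mod_cast ρ.den_ne_zero
  have hvρ : v 1 = ρ * v 0 := by rw [hρ]; field_simp
  have hnum : (ρ : ℝ) = ρ.num / ρ.den := Rat.cast_def ρ
  refine key (v 0 / ρ.den) ![ρ.den, ρ.num] ![y, x] (div_ne_zero h0 hd) ?_ ?_
  · simp; linarith
  · ext i; fin_cases i
    · simp [hd]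
    · simp [hvρ, hnum]; field_simp

theorem IsHyperbolicFrame.isIrrationalPair {A : GL (Fin 2) ℤ} {e : Fin 2 → Plane} {ev : Fin 2 → ℝ}
    (h : IsHyperbolicFrame A e ev) : IsIrrationalPair e := by
  have hs := h.stable_lt
  have hu := h.unstable_gt
  refine ⟨?_, fun j => irrationalSlope_of_eigenvector A (h.ne_zero j) (c := ev j) ?_ (h.eigen j)⟩
  · have he : e = ![e 0, e 1] := by ext i; fin_cases i <;> rfl
    rw [he, LinearIndependent.pair_iff' (h.ne_zero 0)]
    intro a ha
    have h1 := h.eigen 1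
    rw [← ha, Matrix.mulVec_smul, h.eigen 0, smul_comm, ha] at h1
    rw [smul_left_injective ℝ (h.ne_zero 1) h1] at hs
    linarith
  · fin_cases j
    · exact hs.ne
    · exact hu.ne'

namespace TConfiguration

variable {e : Fin 2 → Plane} {T : TConfiguration e} {A : GL (Fin 2) ℤ} {ev : Fin 2 → ℝ}

/-- In the coordinates given by the crossbar and the leg, a toral automorphism that fixes the initial
point is diagonal. -/
theorem toralAut_proj (h : IsHyperbolicFrame A e ev)
    (hfix : toralAut A T.initialPoint = T.initialPoint) (x y : ℝ) :
    toralAut A (T.proj (x, y)) = T.proj (ev T.bar * x, ev (1 - T.bar) * y) := by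
  have h1 : torusProj ((realMatrix A).mulVec T.base) = torusProj T.base := by
    rw [← toralAut_torusProj]
    exact hfix
  have h2 : (realMatrix A).mulVec (framePoint T.base (e T.bar) T.legDirection (x, y)) =
      (realMatrix A).mulVec T.base + ((ev T.bar * x) • e T.bar +
        (ev (1 - T.bar) * y) • T.legDirection) := by
    simp only [framePoint, legDirection, Matrix.mulVec_add, Matrix.mulVec_smul, h.eigen]
    module
  rw [proj, frameProj, toralAut_torusProj, h2, torusProj_add, h1, ← torusProj_add, ← add_assoc]
  rfl

theorem scale_mem_lattice_iff (h : IsHyperbolicFrame A e ev)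
    (hfix : toralAut A T.initialPoint = T.initialPoint) (x y : ℝ) :
    (ev T.bar * x, ev (1 - T.bar) * y) ∈ T.lattice ↔ (x, y) ∈ T.lattice := by
  have h1 : ∀ z, z ∈ T.lattice ↔ T.proj 0 = T.proj z := fun z => by rw [proj_eq_iff, sub_zero]
  have h0 : T.proj 0 = toralAut A (T.proj 0) := by
    have := toralAut_proj h hfix 0 0
    simpa [← Prod.zero_eq_mk] using this.symm
  rw [h1, h1, ← toralAut_proj h hfix, h0, (toralAut_injective A).eq_iff, ← h0]

end TConfiguration

/-! ### Scalings of the axes that preserve the lattice of a stair basis. -/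

namespace IsStairBasis

variable {Λ : AddSubgroup (ℝ × ℝ)} {a b s t κ μ : ℝ}

/-- The scaling sends the hit `B`, at height `max s t`, to a strictly higher hit of the crossbar.
Above `max s t` there is no hit below `s + t`. -/
theorem add_le_mul_max (h : IsStairBasis Λ a b s t) (hμ : 1 < μ)
    (hmem : ∀ x y, (x, y) ∈ Λ → (κ * x, μ * y) ∈ Λ)
    (hI : ∀ x ∈ Icc (-a) b, κ * x ∈ Icc (-a) b) : s + t ≤ μ * max s t := by
  have ha := h.a_pos
  have hb := h.b_pos
  have hs := h.s_pos
  have ht := h.t_pos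
  have key : ∀ x y, (x, y) ∈ Λ → -x ∈ Icc (-a) b → 0 < y → s ≤ y → t ≤ y → s + t ≤ μ * y := by
    intro x y hxy hx hy hsy hty
    by_contra! hlt
    have h1 := hI _ hx
    have hyμ : y < μ * y := by nlinarith
    have := h.height_of_mem (hmem x y hxy) ⟨by linarith [h1.2], by linarith [h1.1]⟩
      (by linarith) hlt.le
    simp only [Prod.mk.injEq] at this
    rcases this with h2 | h2 | h2 | h2 <;> linarith [h2.2]
  rcases le_total s t with hst | hst
  · rw [max_eq_right hst]
    exact key _ _ h.left_mem ⟨by linarith, by linarith⟩ ht hst le_rfl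
  · rw [max_eq_left hst]
    exact key _ _ h.right_mem ⟨by linarith, by linarith⟩ hs le_rfl hst

/-- A contraction of the crossbar that preserves the lattice, together with an expansion of the leg,
maps the crossbar into the one of its two parts cut off by the next hit that contains the origin. -/
theorem scale_crossbar (h : IsStairBasis Λ a b s t) (hΛ : IsAxisFree Λ) (hμ : 1 < μ)
    (hκ0 : κ ≠ 0) (hκ1 : |κ| < 1) (hmem : ∀ x y, (x, y) ∈ Λ → (x / κ, y / μ) ∈ Λ) :
    (∀ x ∈ Icc (-a) b, κ * x ∈ Icc (-a) (b - a)) ∨ ∀ x ∈ Icc (-a) b, κ * x ∈ Icc (b - a) b := by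
  have ha := h.a_pos
  have hb := h.b_pos
  have hs := h.s_pos
  have ht := h.t_pos
  have hμ0 : 0 < μ := by linarith
  have hfst : ∀ {x x' y : ℝ}, (x, y) ∈ Λ → (x', y) ∈ Λ → x = x' := fun h1 h2 =>
    sub_eq_zero.1 (hΛ.fst _ (by simpa using Λ.sub_mem h1 h2))
  -- A hit at height at most `s + t` inside the scaled crossbar would pull back to an interior hit
  -- of the crossbar at positive height below `s + t`. The only hits there are its endpoints.
  have key : ∀ x y, (x, y) ∈ Λ → 0 < y → y ≤ s + t → -x / κ ∉ Ioo (-a) b := by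
    intro x y hxy hy0 hy1 hx
    have hlt : y / μ < y := div_lt_self hy0 hμ
    have hpos : 0 < y / μ := div_pos hy0 hμ0
    have hx' : x / κ = -(-x / κ) := by ring
    have := h.height_of_mem (hmem x y hxy) ⟨by linarith [hx.2], by linarith [hx.1]⟩
      hpos.le (by linarith)
    simp only [Prod.mk.injEq] at this
    rcases this with h2 | h2 | h2 | h2 <;> linarith [h2.1, h2.2, hx.1, hx.2]
  have hw : (a - b, s + t) ∈ Λ := by
    have := Λ.add_mem h.right_mem h.left_mem
    simpa [sub_eq_add_neg] using this
  have kA := key _ _ h.right_mem hs (by linarith)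
  have kB := key _ _ h.left_mem ht (by linarith)
  have kC := key _ _ hw (by linarith) le_rfl
  -- `C` differs from `P`, so the origin is strictly on one side of `C`. The scaled crossbar
  -- contains the origin and has none of `A`, `B`, `C` in its interior, so it stays on that side.
  have hne : a ≠ b := by
    rintro rfl
    rw [sub_self] at hw
    linarith [hΛ.snd _ hw]
  obtain ⟨k0, k1⟩ := abs_lt.1 hκ1
  simp only [mem_Ioo, not_and_or, not_lt] at kA kB kC
  rcases hκ0.lt_or_gt with hκ | hκ
  · simp only [div_le_iff_of_neg hκ, le_div_iff_of_neg hκ] at kA kB kC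
    have hA : -a ≤ b * κ := by
      rcases kA with h1 | h1
      · nlinarith
      · linarith
    have hB : -a * κ ≤ b := by
      rcases kB with h1 | h1
      · linarith
      · nlinarith
    rcases hne.lt_or_gt with hab | hab
    · left
      intro x hx
      have hC : -a * κ ≤ b - a := by
        rcases kC with h1 | h1
        · linarith
        · nlinarith
      constructor <;> nlinarith [hx.1, hx.2]
    · right
      intro x hx
      have hC : b - a ≤ b * κ := by
        rcases kC with h1 | h1
        · nlinarith
        · linarith
      constructor <;> nlinarith [hx.1, hx.2]
  · simp only [div_le_iff₀ hκ, le_div_iff₀ hκ] at kA kB kC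
    rcases hne.lt_or_gt with hab | hab
    · left
      intro x hx
      have hC : b * κ ≤ b - a := by
        rcases kC with h1 | h1
        · nlinarith
        · linarith
      constructor <;> nlinarith [hx.1, hx.2]
    · right
      intro x hx
      have hC : b - a ≤ -a * κ := by
        rcases kC with h1 | h1
        · linarith
        · nlinarith
      constructor <;> nlinarith [hx.1, hx.2]

end IsStairBasis

/-! ### Sides of the parallelograms and the pre-Markov property. -/

namespace TConfiguration

variable {e : Fin 2 → Plane} {T : TConfiguration e} {s t : ℝ}

theorem proj_image_subset {U V : Set (ℝ × ℝ)} {v : ℝ × ℝ} (hv : v ∈ T.lattice)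
    (h : ∀ z ∈ U, z + v ∈ V) : T.proj '' U ⊆ T.proj '' V := by
  rintro _ ⟨z, hz, rfl⟩
  exact ⟨z + v, h z hz, (proj_eq_iff.2 (by simpa using hv)).symm⟩

namespace IsStair

theorem sides_bar (h : T.IsStair s t) (i : Fin 2) (S : Set Torus)
    (hS : (stairParallelogram e T.base T.bar T.sign h.basis i).IsSide T.bar S) :
    S ⊆ T.proj '' (Icc T.lo T.hi ×ˢ {0}) := by
  have h1 := T.lo_neg
  have h2 := T.hi_pos
  rcases (by omega : i = 0 ∨ i = 1) with rfl | rfl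
  · obtain ⟨y, rfl | rfl, rfl⟩ :=
      (boxParallelogram_isSide_bar h.basis.b_pos h.basis.s_pos T.sign_eq _).1 hS
    · refine proj_image_subset (v := 0) T.lattice.zero_mem ?_
      rintro ⟨x, y⟩ ⟨hx, hy⟩
      exact ⟨⟨by simp; linarith [hx.1], by simpa using hx.2⟩, by simpa using hy⟩
    · refine proj_image_subset (T.lattice.neg_mem h.basis.right_mem) ?_
      rintro ⟨x, y⟩ ⟨hx, rfl⟩
      exact ⟨⟨by simpa using hx.1, by simp; linarith [hx.2]⟩, by simp⟩
  · obtain ⟨y, rfl | rfl, rfl⟩ :=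
      (boxParallelogram_isSide_bar (neg_lt_zero.2 h.basis.a_pos) h.basis.t_pos T.sign_eq _).1 hS
    · refine proj_image_subset (v := 0) T.lattice.zero_mem ?_
      rintro ⟨x, y⟩ ⟨hx, hy⟩
      exact ⟨⟨by simpa using hx.1, by simp; linarith [hx.2]⟩, by simpa using hy⟩
    · refine proj_image_subset (T.lattice.neg_mem h.basis.left_mem) ?_
      rintro ⟨x, y⟩ ⟨hx, rfl⟩
      simp only [neg_neg] at hx
      exact ⟨⟨by simp; linarith [hx.1], by simp; linarith [hx.2]⟩, by simp⟩

/-- The inner side of each box is already on the leg; `(-b, t)` carries the right edge of the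
L-shape onto heights `[t, s + t]`, and `(a, s)` carries the left edge onto `[s, s + t]`. -/
theorem sides_leg (h : T.IsStair s t) (i : Fin 2) (S : Set Torus)
    (hS : (stairParallelogram e T.base T.bar T.sign h.basis i).IsSide (1 - T.bar) S) :
    S ⊆ T.proj '' ({0} ×ˢ Icc 0 (s + t)) := by
  have h1 := h.basis.s_pos
  have h2 := h.basis.t_pos
  rcases (by omega : i = 0 ∨ i = 1) with rfl | rfl
  · obtain ⟨x, rfl | rfl, rfl⟩ :=
      (boxParallelogram_isSide_leg h.basis.b_pos h.basis.s_pos T.sign_eq _).1 hS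
    · refine proj_image_subset (v := 0) T.lattice.zero_mem ?_
      rintro ⟨x, y⟩ ⟨hx, hy⟩
      exact ⟨by simpa using hx, by simpa using hy.1, by simp; linarith [hy.2]⟩
    · refine proj_image_subset h.basis.left_mem ?_
      rintro ⟨x, y⟩ ⟨rfl, hy⟩
      exact ⟨by simp, by simp; linarith [hy.1], by simp; linarith [hy.2]⟩
  · obtain ⟨x, rfl | rfl, rfl⟩ :=
      (boxParallelogram_isSide_leg (neg_lt_zero.2 h.basis.a_pos) h.basis.t_pos T.sign_eq _).1 hS
    · refine proj_image_subset h.basis.right_mem ?_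
      rintro ⟨x, y⟩ ⟨rfl, hy⟩
      exact ⟨by simp, by simp; linarith [hy.1], by simp; linarith [hy.2]⟩
    · refine proj_image_subset (v := 0) T.lattice.zero_mem ?_
      rintro ⟨x, y⟩ ⟨hx, hy⟩
      exact ⟨by simpa using hx, by simpa using hy.1, by simp; linarith [hy.2]⟩

theorem exists_side_leg (h : T.IsStair s t) :
    ∃ i, (stairParallelogram e T.base T.bar T.sign h.basis i).IsSide (1 - T.bar)
      (T.proj '' ({0} ×ˢ Icc 0 (max s t))) := by
  rcases le_total s t with hst | hst
  · rw [max_eq_right hst]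
    exact ⟨1,
      (boxParallelogram_isSide_leg (neg_lt_zero.2 h.basis.a_pos) h.basis.t_pos T.sign_eq _).2
        ⟨0, Or.inr rfl, rfl⟩⟩
  · rw [max_eq_left hst]
    exact ⟨0,
      (boxParallelogram_isSide_leg h.basis.b_pos h.basis.s_pos T.sign_eq _).2
        ⟨0, Or.inl rfl, rfl⟩⟩

/-- The generators lower the top sides of the two boxes to the crossbar, where they become its two
parts on either side of `C`, at parameter `hi + lo`. -/
theorem exists_side_bar_left (h : T.IsStair s t) :
    ∃ i S, (stairParallelogram e T.base T.bar T.sign h.basis i).IsSide T.bar S ∧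
      T.proj '' (Icc T.lo (T.hi + T.lo) ×ˢ {0}) ⊆ S := by
  refine ⟨0, _,
    (boxParallelogram_isSide_bar h.basis.b_pos h.basis.s_pos T.sign_eq _).2
      ⟨s, Or.inr rfl, rfl⟩, ?_⟩
  refine proj_image_subset h.basis.right_mem ?_
  rintro ⟨x, y⟩ ⟨hx, rfl⟩
  exact ⟨⟨by simpa using hx.1, by simp; linarith [hx.2]⟩, by simp⟩

theorem exists_side_bar_right (h : T.IsStair s t) :
    ∃ i S, (stairParallelogram e T.base T.bar T.sign h.basis i).IsSide T.bar S ∧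
      T.proj '' (Icc (T.hi + T.lo) T.hi ×ˢ {0}) ⊆ S := by
  refine ⟨1, _,
    (boxParallelogram_isSide_bar (neg_lt_zero.2 h.basis.a_pos) h.basis.t_pos T.sign_eq _).2
      ⟨t, Or.inr rfl, rfl⟩, ?_⟩
  refine proj_image_subset h.basis.left_mem ?_
  rintro ⟨x, y⟩ ⟨hx, rfl⟩
  exact ⟨⟨by simp; linarith [hx.1], by simpa using hx.2⟩, by simp⟩

/-- If a scaling of the two axes preserves the lattice, contracts the crossbar and expands the leg,
then the sides along the crossbar are mapped into such sides, and the sides along the leg are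
covered by the images of such sides. -/
theorem sides_scale (he : IsIrrationalPair e) (h : T.IsStair s t) {R : Fin 2 → Parallelogram e}
    (hR : T.CutsInto (s + t) R) {κ μ : ℝ} (hμ : 1 < μ) (hκ0 : κ ≠ 0) (hκ1 : |κ| < 1)
    (hmem : ∀ x y, (κ * x, μ * y) ∈ T.lattice ↔ (x, y) ∈ T.lattice) (i : Fin 2) (S : Set Torus) :
    ((R i).IsSide T.bar S → S ⊆ T.proj '' (Icc T.lo T.hi ×ˢ {0}) ∧
      ∃ j S', (R j).IsSide T.bar S' ∧ ∀ x ∈ Icc T.lo T.hi, T.proj (κ * x, 0) ∈ S') ∧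
    ((R i).IsSide (1 - T.bar) S → S ⊆ T.proj '' ({0} ×ˢ Icc 0 (s + t)) ∧
      ∃ j S', (R j).IsSide (1 - T.bar) S' ∧ ∀ y ∈ Icc 0 (s + t), T.proj (0, y / μ) ∈ S') := by
  have hμ0 : 0 < μ := by linarith
  have hΛ : IsAxisFree T.lattice := he.isAxisFree T.bar T.sign_ne_zero
  have hC := h.cutsInto he
  have hU := hR.compl_eq.symm.trans hC.compl_eq
  -- An arbitrary partition cut out by the same arcs has the same projected sides as the standard
  -- one, so the work is done with the latter.
  have fwd : ∃ i', ∀ k S, (R i).IsSide k S ↔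
      (stairParallelogram e T.base T.bar T.sign h.basis i').IsSide k S := by
    obtain ⟨i', h1, h2⟩ :=
      exists_corner_eq_and_len_eq he hR.quasiMarkov hC.quasiMarkov hU i
    exact ⟨i', Parallelogram.isSide_congr h1 h2⟩
  have bwd : ∀ i', ∃ i, ∀ k S, (stairParallelogram e T.base T.bar T.sign h.basis i').IsSide k S ↔
      (R i).IsSide k S := by
    intro i'
    obtain ⟨i, h1, h2⟩ :=
      exists_corner_eq_and_len_eq he hC.quasiMarkov hR.quasiMarkov hU.symm i'
    exact ⟨i, Parallelogram.isSide_congr h1 h2⟩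
  obtain ⟨i', hi'⟩ := fwd
  have hscale := h.basis.scale_crossbar hΛ hμ hκ0 hκ1 fun x y hxy => by
    rw [← hmem]
    convert hxy using 2 <;> field_simp
  simp only [neg_neg, sub_neg_eq_add] at hscale
  have hI : ∀ x ∈ Icc T.lo T.hi, κ * x ∈ Icc T.lo T.hi := by
    intro x hx
    have h1 := T.lo_neg
    have h2 := T.hi_pos
    rcases hscale with hs | hs <;> have := hs x hx <;> constructor <;> linarith [this.1, this.2]
  have hmax := h.basis.add_le_mul_max hμ (fun x y hxy => (hmem x y).2 hxy) (by simpa using hI)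
  refine ⟨fun hS => ⟨h.sides_bar i' S ((hi' _ _).1 hS), ?_⟩,
    fun hS => ⟨h.sides_leg i' S ((hi' _ _).1 hS), ?_⟩⟩
  · have : ∃ k S', (stairParallelogram e T.base T.bar T.sign h.basis k).IsSide T.bar S' ∧
        ∀ x ∈ Icc T.lo T.hi, T.proj (κ * x, 0) ∈ S' := by
      rcases hscale with hs | hs
      · obtain ⟨k, S', hS', hsub⟩ := h.exists_side_bar_left
        exact ⟨k, S', hS', fun x hx => hsub ⟨(κ * x, 0), ⟨hs x hx, rfl⟩, rfl⟩⟩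
      · obtain ⟨k, S', hS', hsub⟩ := h.exists_side_bar_right
        exact ⟨k, S', hS', fun x hx => hsub ⟨(κ * x, 0), ⟨hs x hx, rfl⟩, rfl⟩⟩
    obtain ⟨k, S', hS', hsub⟩ := this
    obtain ⟨j, hj⟩ := bwd k
    exact ⟨j, S', (hj _ _).1 hS', hsub⟩
  · obtain ⟨k, hS'⟩ := h.exists_side_leg
    obtain ⟨j, hj⟩ := bwd k
    refine ⟨j, _, (hj _ _).1 hS', fun y hy => ⟨(0, y / μ), ⟨rfl, div_nonneg hy.1 hμ0.le, ?_⟩, rfl⟩⟩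
    rw [div_le_iff₀ hμ0]
    linarith [hy.2]

end IsStair

/-- A positive eigenvalue on the leg keeps the projected ray invariant. The sign of the other
eigenvalue is immaterial, since the crossbar extends to both sides of `P`. -/
theorem isPreMarkovPartition_of_cutsInto {A : GL (Fin 2) ℤ} {ev : Fin 2 → ℝ}
    (hA : IsHyperbolicFrame A e ev) (hfix : toralAut A T.initialPoint = T.initialPoint)
    (hpos : 0 < ev (1 - T.bar)) (h : T.IsStair s t) {R : Fin 2 → Parallelogram e}
    (hR : T.CutsInto (s + t) R) : IsPreMarkovPartition A e R := by
  have he := hA.isIrrationalPair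
  have hΛ : IsAxisFree T.lattice := he.isAxisFree T.bar T.sign_ne_zero
  have hmem := scale_mem_lattice_iff hA hfix
  have hproj := toralAut_proj hA hfix
  have hs := hA.stable_lt
  have hu := hA.unstable_gt
  have hbar : ev T.bar ≠ 0 := by
    intro h0
    have h1 := (hmem T.hi 0).1 (by rw [h0, zero_mul, mul_zero]; exact T.lattice.zero_mem)
    exact T.hi_pos.ne' (hΛ.fst _ h1)
  rcases eq_or_eq_one_sub T.bar 0 with hb | hb
  · have hb' : 1 - T.bar = 1 := by rw [hb]; rfl
    have key := h.sides_scale he hR (κ := ev T.bar) (μ := ev (1 - T.bar))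
      (by rw [hb'] at hpos ⊢; rwa [abs_of_pos hpos] at hu) hbar (by rwa [hb]) hmem
    refine ⟨⟨ev, hA⟩, hR.quasiMarkov, fun i S hS => ?_, fun i S hS => ?_⟩
    · rw [← hb] at hS
      obtain ⟨h1, j, S', hS', h2⟩ := (key i S).1 hS
      refine ⟨j, S', by rwa [hb] at hS', ?_⟩
      rintro _ ⟨p, hp, rfl⟩
      obtain ⟨⟨x, y⟩, ⟨hx, rfl⟩, rfl⟩ := h1 hp
      rw [hproj, mul_zero]
      exact h2 x hx
    · rw [← hb'] at hS
      obtain ⟨h1, j, S', hS', h2⟩ := (key i S).2 hS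
      refine ⟨j, S', by rwa [hb'] at hS', fun p hp => ?_⟩
      obtain ⟨⟨x, y⟩, ⟨rfl, hy⟩, rfl⟩ := h1 hp
      refine ⟨_, h2 y hy, ?_⟩
      rw [hproj, mul_zero, mul_div_cancel₀ _ hpos.ne']
  -- Here the leg is stable, so it is the inverse automorphism that contracts the crossbar and
  -- expands the leg.
  · have hb1 : T.bar = 1 := hb
    have hb' : 1 - T.bar = 0 := by rw [hb1]; rfl
    have hlt : ev (1 - T.bar) < 1 := by
      rw [hb'] at hpos ⊢
      rwa [abs_of_pos hpos] at hs
    have key := h.sides_scale he hR (κ := (ev T.bar)⁻¹) (μ := (ev (1 - T.bar))⁻¹)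
      ((one_lt_inv₀ hpos).2 hlt) (inv_ne_zero hbar)
      (by rw [hb1, abs_inv]; exact inv_lt_one_of_one_lt₀ hu)
      (fun x y => by rw [← hmem, mul_inv_cancel_left₀ hbar, mul_inv_cancel_left₀ hpos.ne'])
    refine ⟨⟨ev, hA⟩, hR.quasiMarkov, fun i S hS => ?_, fun i S hS => ?_⟩
    · rw [← hb'] at hS
      obtain ⟨h1, j, S', hS', h2⟩ := (key i S).2 hS
      refine ⟨j, S', by rwa [hb'] at hS', ?_⟩
      rintro _ ⟨p, hp, rfl⟩
      obtain ⟨⟨x, y⟩, ⟨rfl, hy⟩, rfl⟩ := h1 hp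
      have := h2 y hy
      rw [div_inv_eq_mul, mul_comm] at this
      rwa [hproj, mul_zero]
    · rw [← hb1] at hS
      obtain ⟨h1, j, S', hS', h2⟩ := (key i S).1 hS
      refine ⟨j, S', by rwa [hb1] at hS', fun p hp => ?_⟩
      obtain ⟨⟨x, y⟩, ⟨hx, rfl⟩, rfl⟩ := h1 hp
      refine ⟨_, h2 x hx, ?_⟩
      rw [hproj, mul_zero, mul_inv_cancel_left₀ hbar]

end TConfiguration

theorem mainTheorem4 :
    (∀ e : Fin 2 → Plane, IsIrrationalPair e →
      (∀ T : TConfiguration e, ∃ c : ℝ, T.IsNextHit c ∧ T.legPoint c ∈ T.crossbarInterior ∧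
        ∃ R : Fin 2 → Parallelogram e, T.CutsInto c R) ∧
      (∀ R : Fin 2 → Parallelogram e, IsQuasiMarkovPartition e R →
        ∃ (T : TConfiguration e) (c : ℝ), T.IsNextHit c ∧ T.CutsInto c R)) ∧
    (∀ (A : GL (Fin 2) ℤ) (e : Fin 2 → Plane) (ev : Fin 2 → ℝ), IsHyperbolicFrame A e ev →
      ∀ T : TConfiguration e, toralAut A T.initialPoint = T.initialPoint →
        0 < ev (1 - T.bar) →
        ∃ c : ℝ, T.IsNextHit c ∧ (∃ R : Fin 2 → Parallelogram e, T.CutsInto c R) ∧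
          ∀ R : Fin 2 → Parallelogram e, T.CutsInto c R → IsPreMarkovPartition A e R) := by
  refine ⟨fun e he => ⟨fun T => ?_, fun R hR =>
    exists_tConfiguration_of_isQuasiMarkovPartition he hR⟩, fun A e ev hA T hfix hpos => ?_⟩
  · obtain ⟨s, t, h⟩ := T.exists_isStair he
    exact ⟨s + t, h.isNextHit, h.legPoint_mem_crossbarInterior, _, h.cutsInto he⟩
  · have he := hA.isIrrationalPair
    obtain ⟨s, t, h⟩ := T.exists_isStair he
    exact ⟨s + t, h.isNextHit, ⟨_, h.cutsInto he⟩, fun R hR =>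
      TConfiguration.isPreMarkovPartition_of_cutsInto hA hfix hpos h hR⟩
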